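/- Consider a line network $v_0\to v_1\to\cdots\to v_L$ of $L\ge 1$ identical links. Time is slotted; in every slot $t=0,1,2,\dots$ every node $v_0,\dots,v_{L-1}$ transmits one packet to the next node, and every transmission is, independently of all others, received (without delay) with probability $p$ and erased with probability $1-p$, where $0<p<1$ (deterministic regular traffic with Bernoulli losses). The source $v_0$ holds $k$ message vectors over $\mathbb F_2$. In a dense code, each packet of the source is a random linear combination of the $k$ message vectors, and each packet of an interior node is a random linear combination of all packets which that node received in earlier slots; all coefficients (one for each node, each transmission slot and each message vector, respectively each earlier slot) are independent and uniform on $\mathbb F_2$, and independent of the erasures. The coding delay of a code (a choice of all coefficients) with a given erasure pattern is the least $N$ such that the sink $v_L$ has received, in the first $N$ slots, $k$ packets whose coefficient vectors with respect to the messages are linearly independent. The average coding delay of a code is the expectation of its coding delay over the erasures only, so that it is a random variable depending on the random code. For $0<\varepsilon<1$, the $\varepsilon$-constrained average coding delay $\bar N_{\varepsilon}(k,L,p)$ is the infimum of all $N\in\mathbb Z$ such that the average coding delay of the random dense code is larger than $N$ with probability at most $\varepsilon$. Write $\log=\log_2$. **Theorem.** Fix $0<p<1$. Let $L=L_k\ge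 1$ be integers and $\varepsilon=\varepsilon_k\in(0,1)$, for $k\in\mathbb N$, with $L\log(kL/\varepsilon)=o(k)$ as $k\to\infty$ (for instance, $L$ and $\varepsilon$ constant), and let $w=w_k$ be real numbers with $$w\sim\left(\frac{kL}{\log(kL/(p\varepsilon))}\right)^{1/2}\qquad(k\to\infty).$$ Then, for all sufficiently large $k$, $$\bar N_\varepsilon(k,L,p)\le\frac1p\left(k+(1+o(1))\left(\frac{kL}{w}+w\log\frac{wL}{\varepsilon}\right)\right),$$ where the $o(1)$ term goes to $0$ as $k\to\infty$. If, moreover, $\varepsilon$ goes to $0$ at most polynomially fast (that is, $\varepsilon_k\ge k^{-c}$ for some constant $c$ and all large $k$; for instance, $\varepsilon$ constant), then also, for all sufficiently large $k$, $$\bar N_\varepsilon(k,L,p)\le\frac1p\left(k+(1+o(1))\sqrt{kL\log(kL)}\right).$$ -/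

import Mathlib

open Filter Topology MeasureTheory Asymptotics
open scoped ENNReal

namespace LineNetwork

/-- A dense code (over `𝔽₂`, for `k` message vectors), i.e. a choice of all local encoding
coefficients. Time is slotted, and every node transmits one packet in every slot `t = 0, 1, 2, …`.
* `c.1 (t, j)` is the coefficient of the `j`-th message vector in the packet which the source
  `v₀` transmits in slot `t`.
* `c.2 (i, t, s)` is the coefficient which the interior node `v_{i+1}` gives, in the packet it
  transmits in slot `t`, to the packet that it received in slot `s` (used only if `s < t` and if the
  packet sent to it in slot `s` was not erased). -/
abbrev Code (k : ℕ) : Type := (ℕ × Fin k → ZMod 2) × (ℕ × ℕ × ℕ → ZMod 2)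

/-- A traffic with a transmission opportunity in every slot at every node: `ω (i, t)` tells whether
the transmission in slot `t` over the link from `v_i` to `v_{i+1}` is successful (not erased). -/
abbrev Traffic : Type := ℕ × ℕ → Bool

/-- The global encoding vector of the packet that node `v_i` transmits in slot `t`. An interior node
combines the packets it received in earlier slots. -/
def packet {k : ℕ} (c : Code k) (ω : Traffic) : ℕ → ℕ → (Fin k → ZMod 2)
  | 0, t => fun j => c.1 (t, j)
  | i + 1, t => ∑ s ∈ Finset.range t,
      if ω (i, s) = true then c.2 (i, t, s) • packet c ω i s else 0

/-- The global encoding vectors of the packets that arrive at the sink `v_L` of a line network of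
`L ≥ 1` links during the first `N` slots. -/
def received {k : ℕ} (L : ℕ) (c : Code k) (ω : Traffic) (N : ℕ) : Set (Fin k → ZMod 2) :=
  {x | ∃ s < N, ω (L - 1, s) = true ∧ packet c ω (L - 1) s = x}

/-- The coding delay of the code `c` over the line network of `L` links with traffic `ω`: the least
time `N` by which the sink has received `k` linearly independent packets (`∞` if there is none). -/
noncomputable def codingDelay {k : ℕ} (L : ℕ) (c : Code k) (ω : Traffic) : ℝ≥0∞ :=
  ⨅ (N : ℕ) (_ : Set.finrank (ZMod 2) (received L c ω N) = k), (N : ℝ≥0∞)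

/-- The law of a random dense code: all coefficients are independent and uniform on `𝔽₂`. -/
noncomputable def codeMeasure (k : ℕ) : Measure (Code k) :=
  (Measure.infinitePi fun _ => (PMF.uniformOfFintype (ZMod 2)).toMeasure).prod
    (Measure.infinitePi fun _ => (PMF.uniformOfFintype (ZMod 2)).toMeasure)

/-- The law of the traffic with Bernoulli losses on identical links: all transmissions are
independently successful with probability `p`. -/
noncomputable def trafficMeasure (p : unitInterval) : Measure Traffic :=
  Measure.infinitePi fun _ => ProbabilityTheory.bernoulliMeasure true false p

/-- The average coding delay of the code `c`: its coding delay averaged over the traffics. -/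
noncomputable def averageCodingDelay {k : ℕ} (L : ℕ) (p : unitInterval) (c : Code k) : ℝ≥0∞ :=
  ∫⁻ ω, codingDelay L c ω ∂(trafficMeasure p)

/-- The `ε`-constrained average coding delay: the infimum of the integers `N` such that the average
coding delay of a random dense code is larger than `N` with probability at most `ε`. The infimum is
taken in the extended reals, so that it would be `⊤` if there were no such `N`. -/
noncomputable def constrainedAverageCodingDelay (k L : ℕ) (p : unitInterval) (ε : ℝ) : EReal :=
  ⨅ (N : ℤ) (_ : codeMeasure k {c | ((N : ℝ) : EReal) < (averageCodingDelay L p c : EReal)}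
      ≤ ENNReal.ofReal ε), ((N : ℝ) : EReal)

end LineNetwork

/-! Fix the traffic first. The sink cannot decode exactly when some nonzero functional `φ` kills
every packet it has received. For fixed `φ`, follow the frontier: the last node that has received a
packet not killed by `φ`. Flipping one coefficient shows that `φ` of the packet sent by the frontier
node is a fair coin given the past. Each successful slot on the frontier link therefore leaves the
frontier in place with probability at most 1/2, and a move also costs a factor 1/2. Compare this
with a tandem of queues served by the same traffic, and let `D` be its number of departures after
`N` slots. Induction on time (`measure_frontier_le`) and a union bound over the `2 ^ k` functionals
(`measure_notSpanning_le`) bound the failure probability over `L` links by `2 ^ k * (N + 1) ^ L *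
2⁻¹ ^ D`.

Now let the traffic be random. The saturated first server is replaced by Bernoulli arrivals of rate
`α = p / (1 + σ)`, which only slows the departures, and the empty queues by stationary ones. By
Burke's theorem (`Balanced.burke`) the departures are then i.i.d. Bernoulli of rate `α`, so their
exponential moment is explicit. A customer changes this moment by a factor between `x` and 1, so
starting empty costs at most a factor 6 per queue. Chernoff's bound gives `measure_tandem_lt_le`.

The average delay is at most the sum over `N` of the failure probabilities. It splits into a part
depending only on the traffic, which counts the slots with too few departures, and a part with
expectation at most `ε` over the code, to which Markov's inequality applies
(`measure_lt_averageCodingDelay_le`). With `σ = √(L / k)` this yields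
`constrainedAverageCodingDelay_le_of_le`: an excess over `k` of order `L * log (k * L / ε) + √(k *
L)`. That is of smaller order than the claimed excess, so both statements hold with `o = 0`. -/

namespace LineNetwork

/-! ### Detection of a functional along the line -/

/-- The node `v_i` has received, before slot `t`, a packet which the functional `φ` does not kill
(the source counts as such a node). -/
def Hit {k : ℕ} (φ : Fin k → ZMod 2) (c : Code k) (ω : Traffic) : ℕ → ℕ → Prop
  | 0, _ => True
  | i + 1, t => ∃ s < t, ω (i, s) = true ∧ φ ⬝ᵥ packet c ω i s ≠ 0

section Hit

variable {k : ℕ} {φ : Fin k → ZMod 2} {c : Code k} {ω : Traffic}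

theorem Hit.mono {i s t : ℕ} (h : Hit φ c ω i s) (hst : s ≤ t) : Hit φ c ω i t := by
  cases i with
  | zero => trivial
  | succ i =>
    obtain ⟨r, hr, h⟩ := h
    exact ⟨r, hr.trans_le hst, h⟩

theorem dotProduct_packet_succ (i t : ℕ) : φ ⬝ᵥ packet c ω (i + 1) t =
    ∑ s ∈ Finset.range t, if ω (i, s) = true then c.2 (i, t, s) * (φ ⬝ᵥ packet c ω i s) else 0 := by
  rw [packet, dotProduct_sum]
  refine Finset.sum_congr rfl fun s _ => ?_
  split_ifs
  · rw [dotProduct_smul, smul_eq_mul]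
  · simp

theorem hit_of_dotProduct_packet_ne_zero {i t : ℕ} (h : φ ⬝ᵥ packet c ω i t ≠ 0) :
    Hit φ c ω i t := by
  cases i with
  | zero => trivial
  | succ i =>
    rw [dotProduct_packet_succ] at h
    obtain ⟨s, hs, h⟩ := Finset.exists_ne_zero_of_sum_ne_zero h
    split_ifs at h with hω
    · exact ⟨s, Finset.mem_range.1 hs, hω, right_ne_zero_of_mul h⟩
    · exact absurd rfl h

theorem hit_succ_succ_iff {i t : ℕ} : Hit φ c ω (i + 1) (t + 1) ↔
    Hit φ c ω (i + 1) t ∨ (ω (i, t) = true ∧ φ ⬝ᵥ packet c ω i t ≠ 0) := by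
  simp only [Hit, Order.lt_add_one_iff]
  constructor
  · rintro ⟨s, hs, h⟩
    rcases hs.lt_or_eq with hs | rfl
    · exact Or.inl ⟨s, hs, h⟩
    · exact Or.inr h
  · rintro (⟨s, hs, h⟩ | h)
    · exact ⟨s, hs.le, h⟩
    · exact ⟨t, le_rfl, h⟩

/-- Packets sent before slot `t` depend only on the coefficients of slots before `t`. -/
theorem packet_congr {c c' : Code k} {i t : ℕ} (h₁ : ∀ s ≤ t, ∀ j, c.1 (s, j) = c'.1 (s, j))
    (h₂ : ∀ i, ∀ s ≤ t, ∀ r, c.2 (i, s, r) = c'.2 (i, s, r)) :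
    packet c ω i t = packet c' ω i t := by
  induction i generalizing t with
  | zero => funext j; exact h₁ t le_rfl j
  | succ i ih =>
    rw [packet, packet]
    refine Finset.sum_congr rfl fun s hs => ?_
    have hs := (Finset.mem_range.1 hs).le
    rw [h₂ i t le_rfl s, ih (fun r hr => h₁ r (hr.trans hs)) fun i r hr => h₂ i r (hr.trans hs)]

theorem hit_congr {c c' : Code k} {i t : ℕ} (h₁ : ∀ s < t, ∀ j, c.1 (s, j) = c'.1 (s, j))
    (h₂ : ∀ i, ∀ s < t, ∀ r, c.2 (i, s, r) = c'.2 (i, s, r)) :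
    Hit φ c ω i t ↔ Hit φ c' ω i t := by
  cases i with
  | zero => rfl
  | succ i =>
    refine exists_congr fun s => and_congr_right fun hs => ?_
    rw [packet_congr (fun r hr => h₁ r (hr.trans_lt hs)) fun i r hr => h₂ i r (hr.trans_lt hs)]

end Hit

/-! ### Symmetry of the code's law, and measurability -/

/-- Adding a constant to a single coordinate preserves the law of i.i.d. uniform bits. -/
theorem measurePreserving_add_single {ι : Type*} [DecidableEq ι] (e : ι) :
    MeasurePreserving (fun c : ι → ZMod 2 => c + Pi.single e 1)
      (Measure.infinitePi fun _ => (PMF.uniformOfFintype (ZMod 2)).toMeasure)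
      (Measure.infinitePi fun _ => (PMF.uniformOfFintype (ZMod 2)).toMeasure) := by
  refine ⟨by fun_prop, ?_⟩
  have h := Measure.infinitePi_map_pi
    (μ := fun _ : ι => (PMF.uniformOfFintype (ZMod 2)).toMeasure)
    (f := fun i (x : ZMod 2) => x + Pi.single (M := fun _ => ZMod 2) e 1 i)
    (fun i => measurable_of_countable _)
  have hu : ∀ a : ZMod 2, (PMF.uniformOfFintype (ZMod 2)).toMeasure.map (· + a) =
      (PMF.uniformOfFintype (ZMod 2)).toMeasure := by
    intro a
    refine Measure.ext_of_singleton fun x => ?_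
    rw [Measure.map_apply (measurable_of_countable _) (measurableSet_singleton x)]
    have : (fun y : ZMod 2 => y + a) ⁻¹' {x} = {x - a} := by
      ext y
      exact eq_sub_iff_add_eq.symm
    rw [this, PMF.toMeasure_apply_singleton _ _ (measurableSet_singleton _),
      PMF.toMeasure_apply_singleton _ _ (measurableSet_singleton _)]
    simp
  simp only [hu] at h
  exact h

theorem measurable_packet {k : ℕ} (i t : ℕ) :
    Measurable fun x : Code k × Traffic => packet x.1 x.2 i t := by
  induction i generalizing t with
  | zero =>
    simp only [packet]
    fun_prop
  | succ i ih =>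
    simp only [packet]
    refine Finset.measurable_sum _ fun s _ => ?_
    refine Measurable.ite ?_ ?_ measurable_const
    · exact measurableSet_eq_fun (by fun_prop) (by fun_prop)
    · exact ((measurable_pi_apply _).comp (measurable_snd.comp measurable_fst)).smul (ih s)

theorem measurableSet_hit {k : ℕ} (φ : Fin k → ZMod 2) (i t : ℕ) :
    MeasurableSet {x : Code k × Traffic | Hit φ x.1 x.2 i t} := by
  cases i with
  | zero => exact MeasurableSet.univ
  | succ i =>
    have : {x : Code k × Traffic | Hit φ x.1 x.2 (i + 1) t} = ⋃ s ∈ Finset.range t,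
        {x | x.2 (i, s) = true} ∩ (fun x => packet x.1 x.2 i s) ⁻¹' {v | φ ⬝ᵥ v ≠ 0} := by
      ext x; simp [Hit, and_left_comm]
    rw [this]
    refine Finset.measurableSet_biUnion _ fun s _ => MeasurableSet.inter ?_ ?_
    · exact measurableSet_eq_fun (by fun_prop) (by fun_prop)
    · exact measurable_packet i s (Set.toFinite _).measurableSet

/-! ### The tandem of queues driven by the traffic -/

/-- The number of customers served by server `i` before slot `t`, in a tandem of queues where the
first server is saturated, all other queues are empty at the beginning, and `ω (i, t)` tells
whether server `i` offers service in slot `t`. -/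
def tandem (ω : Traffic) : ℕ → ℕ → ℕ
  | _, 0 => 0
  | 0, t + 1 => tandem ω 0 t + if ω (0, t) = true then 1 else 0
  | i + 1, t + 1 => tandem ω (i + 1) t +
      if ω (i + 1, t) = true ∧ tandem ω (i + 1) t < tandem ω i t then 1 else 0

section Tandem

variable (ω : Traffic)

@[simp] theorem tandem_zero (i : ℕ) : tandem ω i 0 = 0 := by cases i <;> rfl

theorem tandem_zero_succ (t : ℕ) :
    tandem ω 0 (t + 1) = tandem ω 0 t + if ω (0, t) = true then 1 else 0 := rfl

theorem tandem_succ_succ (i t : ℕ) : tandem ω (i + 1) (t + 1) = tandem ω (i + 1) t +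
    if ω (i + 1, t) = true ∧ tandem ω (i + 1) t < tandem ω i t then 1 else 0 := rfl

theorem tandem_le_tandem_add (i t : ℕ) :
    tandem ω i (t + 1) ≤ tandem ω i t + if ω (i, t) = true then 1 else 0 := by
  cases i with
  | zero => exact le_rfl
  | succ i =>
    rw [tandem_succ_succ]
    split_ifs <;> simp_all

theorem tandem_mono_time (i t : ℕ) : tandem ω i t ≤ tandem ω i (t + 1) := by
  cases i with
  | zero => exact Nat.le_add_right _ _
  | succ i => exact Nat.le_add_right _ _

theorem tandem_succ_le (i t : ℕ) : tandem ω (i + 1) t ≤ tandem ω i t := by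
  induction t with
  | zero => simp
  | succ t ih =>
    refine le_trans ?_ (tandem_mono_time ω i t)
    rw [tandem_succ_succ]
    split_ifs <;> omega

theorem tandem_antitone (t : ℕ) : Antitone fun i => tandem ω i t :=
  antitone_nat_of_succ_le fun i => tandem_succ_le ω i t

end Tandem

/-! ### Failure probability over the code, for fixed traffic -/

/-- The node `v_j` is the last one that has received, before slot `t`, a packet not killed by `φ`. -/
def frontier {k : ℕ} (φ : Fin k → ZMod 2) (ω : Traffic) (j t : ℕ) : Set (Code k) :=
  {c | Hit φ c ω j t ∧ ¬ Hit φ c ω (j + 1) t}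

section Frontier

variable {k : ℕ} {φ : Fin k → ZMod 2} (ω : Traffic)

instance : IsProbabilityMeasure (codeMeasure k) := by
  unfold codeMeasure; infer_instance

instance (p : unitInterval) : IsProbabilityMeasure (trafficMeasure p) := by
  unfold trafficMeasure; infer_instance

theorem measurableSet_hit_code (φ : Fin k → ZMod 2) (i t : ℕ) :
    MeasurableSet {c : Code k | Hit φ c ω i t} :=
  (measurableSet_hit φ i t).preimage (measurable_id.prodMk measurable_const)

theorem measurableSet_frontier (φ : Fin k → ZMod 2) (j t : ℕ) :
    MeasurableSet (frontier φ ω j t) :=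
  (measurableSet_hit_code ω φ j t).inter (measurableSet_hit_code ω φ (j + 1) t).compl

theorem measurableSet_dotProduct_packet (φ : Fin k → ZMod 2) (j t : ℕ) :
    MeasurableSet {c : Code k | φ ⬝ᵥ packet c ω j t = 0} :=
  ((measurable_packet j t).comp (measurable_id.prodMk measurable_const))
    (Set.toFinite {v | φ ⬝ᵥ v = 0}).measurableSet

/-- If a measure preserving map stays in `E` and flips a condition on `E`, that condition has
conditional probability at most `1 / 2`. -/
theorem measure_inter_le_half_of_flip {Ω : Type*} [MeasurableSpace Ω] {μ : Measure Ω}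
    {f : Ω → Ω} (hf : MeasurePreserving f μ μ) {E A : Set Ω} (hE : MeasurableSet E)
    (hA : MeasurableSet A) (hfE : ∀ x ∈ E, f x ∈ E) (hfA : ∀ x ∈ E, x ∈ A → f x ∉ A)
    (hfA' : ∀ x ∈ E, x ∉ A → f x ∈ A) :
    μ (E ∩ A) ≤ 2⁻¹ * μ E ∧ μ (E \ A) ≤ 2⁻¹ * μ E := by
  have h1 : μ (E ∩ A) ≤ μ (E \ A) := by
    rw [← hf.measure_preimage (hE.diff hA).nullMeasurableSet]
    exact measure_mono fun x hx => ⟨hfE x hx.1, hfA x hx.1 hx.2⟩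
  have h2 : μ (E \ A) ≤ μ (E ∩ A) := by
    rw [← hf.measure_preimage (hE.inter hA).nullMeasurableSet]
    exact measure_mono fun x hx => ⟨hfE x hx.1, hfA' x hx.1 hx.2⟩
  have h3 : μ (E ∩ A) = μ (E \ A) := h1.antisymm h2
  have h4 := measure_inter_add_sdiff (μ := μ) E hA
  rw [← h3, ← two_mul] at h4
  rw [← h3, ← h4, ← mul_assoc, ENNReal.inv_mul_cancel (by simp) (by simp), one_mul]
  exact ⟨le_rfl, le_rfl⟩

theorem mem_frontier_congr {c c' : Code k} {j t : ℕ} (h₁ : ∀ s < t, ∀ j, c.1 (s, j) = c'.1 (s, j))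
    (h₂ : ∀ i, ∀ s < t, ∀ r, c.2 (i, s, r) = c'.2 (i, s, r)) :
    c ∈ frontier φ ω j t ↔ c' ∈ frontier φ ω j t :=
  and_congr (hit_congr h₁ h₂) (not_congr (hit_congr h₁ h₂))

/-- The code obtained by changing one coefficient of the source. -/
def flipSource (e : ℕ × Fin k) (c : Code k) : Code k := (c.1 + Pi.single e 1, c.2)

/-- The code obtained by changing one coefficient of an interior node. -/
def flipInner (e : ℕ × ℕ × ℕ) (c : Code k) : Code k := (c.1, c.2 + Pi.single e 1)

theorem measurePreserving_flipSource (e : ℕ × Fin k) :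
    MeasurePreserving (flipSource e) (codeMeasure k) (codeMeasure k) :=
  (measurePreserving_add_single e).prod (MeasurePreserving.id _)

theorem measurePreserving_flipInner (e : ℕ × ℕ × ℕ) :
    MeasurePreserving (flipInner (k := k) e) (codeMeasure k) (codeMeasure k) :=
  (MeasurePreserving.id _).prod (measurePreserving_add_single e)

theorem flipInner_apply_of_ne (c : Code k) {e e' : ℕ × ℕ × ℕ} (h : e' ≠ e) :
    c.2 e' = (flipInner e c).2 e' := by
  simp [flipInner, h]

theorem zmod_two_eq_one_of_ne_zero {x : ZMod 2} : x ≠ 0 → x = 1 := by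
  revert x; decide

theorem zmod_two_eq_zero_iff (x : ZMod 2) : x = 0 ↔ x + 1 ≠ 0 := by
  revert x; decide

/-- At the source, the packet of slot `t` is a fair coin independent of the past. -/
theorem frontier_zero_flip (hφ : φ ≠ 0) (t : ℕ) :
    codeMeasure k (frontier φ ω 0 t ∩ {c | φ ⬝ᵥ packet c ω 0 t = 0}) ≤
        2⁻¹ * codeMeasure k (frontier φ ω 0 t) ∧
      codeMeasure k (frontier φ ω 0 t \ {c | φ ⬝ᵥ packet c ω 0 t = 0}) ≤
        2⁻¹ * codeMeasure k (frontier φ ω 0 t) := by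
  obtain ⟨l, hl⟩ := Function.ne_iff.1 hφ
  have hl : φ l = 1 := zmod_two_eq_one_of_ne_zero hl
  have hadd : ∀ c : Code k, φ ⬝ᵥ packet (flipSource (t, l) c) ω 0 t =
      φ ⬝ᵥ packet c ω 0 t + 1 := by
    intro c
    have : packet (flipSource (t, l) c) ω 0 t = packet c ω 0 t + Pi.single l 1 := by
      funext j
      simp [packet, flipSource, Pi.single_apply]
    rw [this, dotProduct_add, dotProduct_single, hl, mul_one]
  refine measure_inter_le_half_of_flip (measurePreserving_flipSource (t, l))
    (measurableSet_frontier ω φ 0 t) (measurableSet_dotProduct_packet ω φ 0 t)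
    (fun c hc => ?_) (fun c _ hc => ?_) (fun c _ hc => ?_)
  · refine (mem_frontier_congr (c := c) (c' := flipSource (t, l) c) ω (fun s hs j => ?_) fun _ _ _ _ => rfl).1 hc
    have : ((s, j) : ℕ × Fin k) ≠ (t, l) := fun h => hs.ne (congrArg Prod.fst h)
    simp [flipSource, this]
  · rw [Set.mem_ofPred_eq, hadd]
    exact (zmod_two_eq_zero_iff _).1 hc
  · rw [Set.mem_ofPred_eq, hadd]
    by_contra h
    exact hc ((zmod_two_eq_zero_iff _).2 h)

/-- At an interior node that has received something not killed by `φ`, first in slot `s`, the packet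
of slot `t` is a fair coin independent of the past. -/
theorem frontier_succ_flip (j : ℕ) {s t : ℕ} (hst : s < t) :
    let E := frontier φ ω (j + 1) t ∩ {c | Hit φ c ω (j + 1) (s + 1) ∧ ¬ Hit φ c ω (j + 1) s}
    MeasurableSet E ∧
      codeMeasure k (E ∩ {c | φ ⬝ᵥ packet c ω (j + 1) t = 0}) ≤ 2⁻¹ * codeMeasure k E ∧
      codeMeasure k (E \ {c | φ ⬝ᵥ packet c ω (j + 1) t = 0}) ≤ 2⁻¹ * codeMeasure k E := by
  intro E
  have hE : MeasurableSet E := (measurableSet_frontier ω φ (j + 1) t).inter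
    ((measurableSet_hit_code ω φ (j + 1) (s + 1)).inter
      (measurableSet_hit_code ω φ (j + 1) s).compl)
  have hcongr : ∀ (c : Code k) (i r : ℕ), r < t → ∀ u,
      c.2 (i, r, u) = (flipInner (j, t, s) c).2 (i, r, u) := by
    intro c i r hr u
    refine flipInner_apply_of_ne c ?_
    simp only [ne_eq, Prod.mk.injEq]; omega
  have hpacket : ∀ (c : Code k) (r : ℕ), r < t →
      packet (flipInner (j, t, s) c) ω j r = packet c ω j r := fun c r hr =>
    (packet_congr (c := c) (c' := flipInner (j, t, s) c)
        (fun _ _ _ => rfl) fun i u hu => hcongr c i u (hu.trans_lt hr)).symm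
  -- The flipped coefficient multiplies the packet of slot `s`, on which `φ` is 1. All packets sent
  -- before slot `t` are unchanged, so only this summand changes.
  have hadd : ∀ c ∈ E, φ ⬝ᵥ packet (flipInner (j, t, s) c) ω (j + 1) t =
      φ ⬝ᵥ packet c ω (j + 1) t + 1 := by
    rintro c ⟨-, h1, h2⟩
    obtain ⟨hω, hne⟩ := (hit_succ_succ_iff.1 h1).resolve_left h2
    rw [dotProduct_packet_succ, dotProduct_packet_succ,
      ← Finset.add_sum_erase _ _ (Finset.mem_range.2 hst),
      ← Finset.add_sum_erase _ _ (Finset.mem_range.2 hst), if_pos hω, if_pos hω, add_right_comm]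
    congr 1
    · rw [hpacket c s hst, zmod_two_eq_one_of_ne_zero hne]
      simp [flipInner]
    · refine Finset.sum_congr rfl fun r hr => ?_
      rw [hpacket c r (Finset.mem_range.1 (Finset.mem_erase.1 hr).2), ← flipInner_apply_of_ne c]
      simpa using (Finset.mem_erase.1 hr).1
  refine ⟨hE, measure_inter_le_half_of_flip (measurePreserving_flipInner (j, t, s)) hE
    (measurableSet_dotProduct_packet ω φ (j + 1) t)
    (fun c hc => ?_) (fun c hc h => ?_) (fun c hc h => ?_)⟩
  · refine ⟨(mem_frontier_congr (c := c) (c' := flipInner (j, t, s) c) ω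
        (fun _ _ _ => rfl) (hcongr c)).1 hc.1,
      (hit_congr (c := c) (c' := flipInner (j, t, s) c)
        (fun _ _ _ => rfl) fun i r hr => hcongr c i r (by omega)).1 hc.2.1,
      fun h => hc.2.2
        ((hit_congr (c := c) (c' := flipInner (j, t, s) c)
        (fun _ _ _ => rfl) fun i r hr => hcongr c i r (by omega)).2 h)⟩
  · rw [Set.mem_ofPred_eq, hadd c hc]
    exact (zmod_two_eq_zero_iff _).1 h
  · rw [Set.mem_ofPred_eq, hadd c hc]
    by_contra h'
    exact h ((zmod_two_eq_zero_iff _).2 h')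

/-- The coefficient to flip depends on when an interior node was first hit, so the frontier event is
partitioned by that slot. -/
theorem frontier_flip (hφ : φ ≠ 0) (j t : ℕ) :
    codeMeasure k (frontier φ ω j t ∩ {c | φ ⬝ᵥ packet c ω j t = 0}) ≤
        2⁻¹ * codeMeasure k (frontier φ ω j t) ∧
      codeMeasure k (frontier φ ω j t \ {c | φ ⬝ᵥ packet c ω j t = 0}) ≤
        2⁻¹ * codeMeasure k (frontier φ ω j t) := by
  cases j with
  | zero => exact frontier_zero_flip ω hφ t
  | succ j =>
    set E : ℕ → Set (Code k) := fun s => frontier φ ω (j + 1) t ∩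
      {c | Hit φ c ω (j + 1) (s + 1) ∧ ¬ Hit φ c ω (j + 1) s} with hEdef
    have hEq : frontier φ ω (j + 1) t = ⋃ s ∈ Finset.range t, E s := by
      refine subset_antisymm (fun c hc => ?_) (Set.iUnion₂_subset fun s _ => Set.inter_subset_left)
      classical
      have hex : ∃ s, Hit φ c ω (j + 1) s := ⟨t, hc.1⟩
      have hle : Nat.find hex ≤ t := Nat.find_min' hex hc.1
      have hspec := Nat.find_spec hex
      rcases h : Nat.find hex with _ | s
      · rw [h] at hspec
        obtain ⟨r, hr, -⟩ := hspec
        exact absurd hr (Nat.not_lt_zero r)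
      · rw [h] at hspec hle
        exact Set.mem_biUnion (x := s) (by simpa using hle)
          ⟨hc, hspec, Nat.find_min hex (m := s) (by omega)⟩
    have hdisj : Set.PairwiseDisjoint (Finset.range t : Set ℕ) E := by
      intro r _ s _ hrs
      refine Set.disjoint_left.2 fun c hr hs => ?_
      rcases hrs.lt_or_gt with h | h
      · exact hs.2.2 (hr.2.1.mono h)
      · exact hr.2.2 (hs.2.1.mono h)
    have hsum : codeMeasure k (frontier φ ω (j + 1) t) =
        ∑ s ∈ Finset.range t, codeMeasure k (E s) := by
      rw [hEq]
      exact measure_biUnion_finset hdisj fun s hs =>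
        (frontier_succ_flip ω j (Finset.mem_range.1 hs)).1
    rw [hsum, Finset.mul_sum]
    constructor
    · rw [hEq, Set.iUnion₂_inter]
      exact (measure_biUnion_finset_le _ _).trans (Finset.sum_le_sum fun s hs =>
        (frontier_succ_flip ω j (Finset.mem_range.1 hs)).2.1)
    · rw [hEq, Set.sdiff_eq_compl_inter, Set.inter_comm, Set.iUnion₂_inter]
      exact (measure_biUnion_finset_le _ _).trans (Finset.sum_le_sum fun s hs =>
        (frontier_succ_flip ω j (Finset.mem_range.1 hs)).2.2)

/-- The probability over the code that the frontier is at `v_j`. -/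
theorem measure_frontier_le (hφ : φ ≠ 0) (j t : ℕ) :
    codeMeasure k (frontier φ ω j t) ≤ t.choose j * 2⁻¹ ^ tandem ω j t := by
  induction t generalizing j with
  | zero =>
    cases j with
    | zero => simpa using prob_le_one
    | succ j =>
      have : frontier φ ω (j + 1) 0 = ∅ := by
        ext c; simp [frontier, Hit]
      simp [this]
  | succ t ih =>
    -- The frontier stays put. If the link succeeds, the packet must be killed, which costs 1/2; the
    -- tandem count grows by at most one, and only in this case.
    have stay : codeMeasure k (frontier φ ω j (t + 1) ∩ {c | Hit φ c ω j t}) ≤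
        t.choose j * 2⁻¹ ^ tandem ω j (t + 1) := by
      by_cases hω : ω (j, t) = true
      · have hsub : frontier φ ω j (t + 1) ∩ {c | Hit φ c ω j t} ⊆
            frontier φ ω j t ∩ {c | φ ⬝ᵥ packet c ω j t = 0} := by
          rintro c ⟨⟨-, h2⟩, h3⟩
          rw [hit_succ_succ_iff] at h2
          push Not at h2
          exact ⟨⟨h3, h2.1⟩, h2.2 hω⟩
        refine (measure_mono hsub).trans ((frontier_flip ω hφ j t).1.trans ?_)
        calc 2⁻¹ * codeMeasure k (frontier φ ω j t)
            ≤ 2⁻¹ * (t.choose j * 2⁻¹ ^ tandem ω j t) := by gcongr; exact ih j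
          _ = t.choose j * 2⁻¹ ^ (tandem ω j t + 1) := by ring
          _ ≤ t.choose j * 2⁻¹ ^ tandem ω j (t + 1) := by
            gcongr _ * ?_
            refine pow_le_pow_right_of_le_one' (by simp) ?_
            simpa [hω] using tandem_le_tandem_add ω j t
      · have hsub : frontier φ ω j (t + 1) ∩ {c | Hit φ c ω j t} ⊆ frontier φ ω j t := by
          rintro c ⟨⟨-, h2⟩, h3⟩
          exact ⟨h3, fun h => h2 (h.mono t.le_succ)⟩
        refine (measure_mono hsub).trans ((ih j).trans ?_)
        gcongr _ * ?_
        refine pow_le_pow_right_of_le_one' (by simp) ?_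
        simpa [hω] using tandem_le_tandem_add ω j t
    cases j with
    | zero =>
      have : frontier φ ω 0 (t + 1) ∩ {c | Hit φ c ω 0 t} = frontier φ ω 0 (t + 1) := by
        simp [Hit]
      rw [this] at stay
      simpa using stay
    | succ j =>
      have hsub : frontier φ ω (j + 1) (t + 1) ⊆
          (frontier φ ω (j + 1) (t + 1) ∩ {c | Hit φ c ω (j + 1) t}) ∪
            (frontier φ ω j t \ {c | φ ⬝ᵥ packet c ω j t = 0}) := by
        intro c hc
        by_cases h : Hit φ c ω (j + 1) t
        · exact Or.inl ⟨hc, h⟩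
        · have h1 := hc.1
          rw [hit_succ_succ_iff] at h1
          obtain h1 | h1 := h1
          · exact absurd h1 h
          · exact Or.inr ⟨⟨hit_of_dotProduct_packet_ne_zero h1.2, h⟩, h1.2⟩
      refine (measure_mono hsub).trans ((measure_union_le _ _).trans ?_)
      -- Pascal's rule matches the two ways to reach `v_{j+1}`: stay there, or advance from `v_j`.
      -- Advancing pays one factor 1/2, enough because server `j + 1` never overtakes server `j`.
      rw [Nat.choose_succ_succ, add_comm (t.choose j), Nat.cast_add, add_mul]
      refine add_le_add stay ((frontier_flip ω hφ j t).2.trans ?_)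
      calc 2⁻¹ * codeMeasure k (frontier φ ω j t)
          ≤ 2⁻¹ * (t.choose j * 2⁻¹ ^ tandem ω j t) := by gcongr; exact ih j
        _ = t.choose j * 2⁻¹ ^ (tandem ω j t + 1) := by ring
        _ ≤ t.choose j * 2⁻¹ ^ tandem ω (j + 1) (t + 1) := by
          gcongr _ * ?_
          refine pow_le_pow_right_of_le_one' (by simp) ?_
          have h1 := tandem_succ_le ω j t
          rw [tandem_succ_succ]
          split_ifs <;> omega

/-- The source is always hit, so if `v_{L+1}` is not, the frontier is at some `v_j` with `j ≤ L`.
Among these servers the last has the fewest departures and gives the weakest exponent. -/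
theorem measure_not_hit_le (hφ : φ ≠ 0) (L N : ℕ) :
    codeMeasure k {c | ¬ Hit φ c ω (L + 1) N} ≤
      (N + 1 : ℕ) ^ (L + 1) * 2⁻¹ ^ tandem ω L N := by
  have hsub : {c : Code k | ¬ Hit φ c ω (L + 1) N} ⊆
      ⋃ j ∈ Finset.range (L + 1), frontier φ ω j N := by
    intro c hc
    classical
    have hex : ∃ j, ¬ Hit φ c ω (j + 1) N := ⟨L, hc⟩
    have hle : Nat.find hex ≤ L := Nat.find_min' hex hc
    refine Set.mem_biUnion (x := Nat.find hex) (by simpa [Nat.lt_succ_iff] using hle)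
      ⟨?_, Nat.find_spec hex⟩
    rcases h : Nat.find hex with _ | j
    · trivial
    · exact not_not.1 (Nat.find_min hex (m := j) (by omega))
  refine (measure_mono hsub).trans ((measure_biUnion_finset_le _ _).trans ?_)
  have hsum : ∑ j ∈ Finset.range (L + 1), N.choose j ≤ (N + 1) ^ (L + 1) := by
    calc ∑ j ∈ Finset.range (L + 1), N.choose j
        ≤ ∑ j ∈ Finset.range (L + 1), N ^ j * 1 ^ (L - j) * L.choose j := by
          refine Finset.sum_le_sum fun j hj => ?_
          rw [one_pow, mul_one]
          refine (Nat.choose_le_pow N j).trans (Nat.le_mul_of_pos_right _ ?_)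
          exact Nat.choose_pos (by simpa [Nat.lt_succ_iff] using hj)
      _ = (N + 1) ^ L := (add_pow N 1 L).symm
      _ ≤ (N + 1) ^ (L + 1) := Nat.pow_le_pow_right (by omega) (by omega)
  calc ∑ j ∈ Finset.range (L + 1), codeMeasure k (frontier φ ω j N)
      ≤ ∑ j ∈ Finset.range (L + 1), (N.choose j : ℝ≥0∞) * 2⁻¹ ^ tandem ω L N := by
        refine Finset.sum_le_sum fun j hj => (measure_frontier_le ω hφ j N).trans ?_
        gcongr _ * ?_
        refine pow_le_pow_right_of_le_one' (by simp) ?_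
        exact tandem_antitone ω N (by simpa [Nat.lt_succ_iff] using hj)
    _ ≤ _ := by
      rw [← Finset.sum_mul]
      gcongr
      exact_mod_cast hsum

/-- If the packets received at the sink do not span, they are killed by a nonzero functional. -/
theorem exists_not_hit_of_finrank_ne {c : Code k} {L N : ℕ}
    (h : Set.finrank (ZMod 2) (received (L + 1) c ω N) ≠ k) :
    ∃ φ : Fin k → ZMod 2, φ ≠ 0 ∧ ¬ Hit φ c ω (L + 1) N := by
  have hlt : Submodule.span (ZMod 2) (received (L + 1) c ω N) < ⊤ := by
    rw [lt_top_iff_ne_top]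
    intro h'
    apply h
    rw [Set.finrank, h', finrank_top, Module.finrank_fin_fun]
  obtain ⟨f, hf, hle⟩ := Submodule.exists_le_ker_of_lt_top _ hlt
  have hfφ : ∀ v, f v = (fun j => f (Pi.single j 1)) ⬝ᵥ v := by
    intro v
    rw [LinearMap.pi_apply_eq_sum_univ f v, dotProduct]
    refine Finset.sum_congr rfl fun j _ => ?_
    rw [smul_eq_mul, mul_comm]
    congr 2
    ext i
    simp [Pi.single_apply, eq_comm]
  refine ⟨fun j => f (Pi.single j 1), fun h0 => hf ?_, ?_⟩
  · refine LinearMap.ext fun v => ?_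
    rw [hfφ, h0, zero_dotProduct, LinearMap.zero_apply]
  · rintro ⟨s, hs, hω, hne⟩
    rw [← hfφ] at hne
    exact hne (hle (Submodule.subset_span ⟨s, hs, hω, rfl⟩))

/-- The codes and traffics for which the packets received at `v_L` before slot `N` are all killed
by some nonzero functional. -/
def notSpanning (k L N : ℕ) : Set (Code k × Traffic) :=
  {x | ∃ φ : Fin k → ZMod 2, φ ≠ 0 ∧ ¬ Hit φ x.1 x.2 L N}

theorem measurableSet_notSpanning (k L N : ℕ) : MeasurableSet (notSpanning k L N) := by
  have : notSpanning k L N = ⋃ φ : Fin k → ZMod 2,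
      {_x | φ ≠ 0} ∩ {x : Code k × Traffic | Hit φ x.1 x.2 L N}ᶜ := by
    ext x; simp [notSpanning]
  rw [this]
  exact MeasurableSet.iUnion fun φ => (MeasurableSet.const _).inter (measurableSet_hit φ L N).compl

theorem measure_notSpanning_le (L N : ℕ) :
    codeMeasure k {c | (c, ω) ∈ notSpanning k (L + 1) N} ≤
      2 ^ k * ((N + 1 : ℕ) ^ (L + 1) * 2⁻¹ ^ tandem ω L N) := by
  classical
  have hsub : {c : Code k | (c, ω) ∈ notSpanning k (L + 1) N} ⊆
      ⋃ φ ∈ (Finset.univ.filter fun φ : Fin k → ZMod 2 => φ ≠ 0),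
        {c | ¬ Hit φ c ω (L + 1) N} := by
    rintro c ⟨φ, h0, h⟩
    exact Set.mem_biUnion (x := φ) (by simpa using h0) h
  refine (measure_mono hsub).trans ((measure_biUnion_finset_le _ _).trans ?_)
  calc _ ≤ ∑ φ ∈ (Finset.univ.filter fun φ : Fin k → ZMod 2 => φ ≠ 0),
        ((N + 1 : ℕ) ^ (L + 1) * 2⁻¹ ^ tandem ω L N : ℝ≥0∞) :=
        Finset.sum_le_sum fun φ hφ => measure_not_hit_le ω (by simpa using hφ) L N
    _ ≤ _ := by
      rw [Finset.sum_const, nsmul_eq_mul]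
      gcongr
      have : (Finset.univ.filter fun φ : Fin k → ZMod 2 => φ ≠ 0).card ≤ 2 ^ k := by
        refine (Finset.card_filter_le _ _).trans ?_
        simp [ZMod.card]
      exact_mod_cast this

end Frontier

/-! ### Integrating out the traffic of one slot -/

/-- Resampling one coordinate does not change a product measure. -/
theorem map_update_infinitePi {ι : Type*} [DecidableEq ι] {X : ι → Type*}
    [∀ i, MeasurableSpace (X i)] (ν : ∀ i, Measure (X i)) [∀ i, IsProbabilityMeasure (ν i)]
    (e : ι) :
    ((Measure.infinitePi ν).prod (ν e)).map (fun x => Function.update x.1 e x.2) =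
      Measure.infinitePi ν := by
  have hmeas : Measurable fun x : (∀ i, X i) × X e => Function.update x.1 e x.2 := by
    refine measurable_pi_lambda _ fun i => ?_
    by_cases h : i = e
    · subst h; simpa using measurable_snd
    · simp only [Function.update_of_ne h]
      exact (measurable_pi_apply i).comp measurable_fst
  refine Measure.eq_infinitePi ν fun s t ht => ?_
  rw [Measure.map_apply hmeas (MeasurableSet.pi s.countable_toSet fun i _ => ht i)]
  by_cases hs : e ∈ s
  · have : (fun x : (∀ i, X i) × X e => Function.update x.1 e x.2) ⁻¹' (Set.pi (s : Set ι) t) =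
        (Set.pi (s.erase e : Set ι) t) ×ˢ t e := by
      ext x
      simp only [Set.mem_preimage, Set.mem_pi, Set.mem_prod, Finset.mem_coe, Finset.mem_erase]
      constructor
      · intro h
        refine ⟨fun i hi => ?_, by simpa using h e hs⟩
        simpa [hi.1] using h i hi.2
      · rintro ⟨h1, h2⟩ i hi
        by_cases h : i = e
        · subst h; simpa using h2
        · simpa [h] using h1 i ⟨h, hi⟩
    rw [this, Measure.prod_prod, Measure.infinitePi_pi ν fun i _ => ht i, mul_comm,
      Finset.mul_prod_erase s (fun i => ν i (t i)) hs]
  · have : (fun x : (∀ i, X i) × X e => Function.update x.1 e x.2) ⁻¹' (Set.pi (s : Set ι) t) =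
        (Set.pi (s : Set ι) t) ×ˢ Set.univ := by
      ext x
      simp only [Set.mem_preimage, Set.mem_pi, Set.mem_prod, Finset.mem_coe, Set.mem_univ, and_true]
      refine forall₂_congr fun i hi => ?_
      have : i ≠ e := fun h => hs (h ▸ hi)
      simp [this]
    rw [this, Measure.prod_prod, Measure.infinitePi_pi ν fun i _ => ht i, measure_univ, mul_one]

/-- The probability that a slot has the given state. -/
noncomputable def weight (p : unitInterval) (b : Bool) : ℝ≥0∞ :=
  ENNReal.ofReal (if b = true then p else 1 - p)

theorem lintegral_bernoulli (p : unitInterval) (f : Bool → ℝ≥0∞) :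
    ∫⁻ b, f b ∂(ProbabilityTheory.bernoulliMeasure true false p) =
      weight p true * f true + weight p false * f false := by
  rw [lintegral_fintype, Fintype.sum_bool,
    ProbabilityTheory.bernoulliMeasure_apply_of_mem_of_notMem p (measurableSet_singleton _) rfl
      (by simp), ProbabilityTheory.bernoulliMeasure_apply_of_notMem_of_mem p
      (measurableSet_singleton _) (by simp) rfl, mul_comm, mul_comm (f false)]
  congr 2
  · simp only [weight, if_true, unitInterval.toNNReal, ENNReal.ofReal]
    congr 1
    ext
    simp only [Real.coe_toNNReal _ p.2.1]
    rfl
  · simp only [weight, unitInterval.toNNReal, ENNReal.ofReal]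
    congr 1
    ext
    rw [if_neg (by simp), Real.coe_toNNReal _ (sub_nonneg.2 p.2.2)]
    rfl

theorem weight_add (p : unitInterval) : weight p true + weight p false = 1 := by
  simp only [weight, if_true, Bool.false_eq_true, if_false]
  rw [← ENNReal.ofReal_add p.2.1 (by linarith [p.2.2])]
  simp

theorem lintegral_traffic_resample (p : unitInterval) (e : ℕ × ℕ) {F : Traffic → ℝ≥0∞}
    (hF : Measurable F) :
    ∫⁻ ω, F ω ∂(trafficMeasure p) =
      ∫⁻ ω, (weight p true * F (Function.update ω e true) +
        weight p false * F (Function.update ω e false)) ∂(trafficMeasure p) := by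
  have hmeas : Measurable fun x : Traffic × Bool => Function.update x.1 e x.2 := by
    refine measurable_pi_lambda _ fun i => ?_
    by_cases h : i = e
    · subst h; simpa using measurable_snd
    · simp only [Function.update_of_ne h]
      exact (measurable_pi_apply i).comp measurable_fst
  conv_lhs => rw [trafficMeasure, ← map_update_infinitePi _ e, lintegral_map hF hmeas]
  rw [lintegral_prod _ (show Measurable fun x : Traffic × Bool =>
    F (Function.update x.1 e x.2) from hF.comp hmeas).aemeasurable]
  simp only [lintegral_bernoulli]
  rfl

/-- The expectation over `n` independent bits. -/
noncomputable def bitsMean (p : unitInterval) : ℕ → (List Bool → ℝ≥0∞) → ℝ≥0∞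
  | 0, h => h []
  | n + 1, h => weight p true * bitsMean p n (fun l => h (true :: l)) +
      weight p false * bitsMean p n (fun l => h (false :: l))

/-- The states of the links `v_i → v_{i+1}, …, v_{i+n-1} → v_{i+n}` in slot `t`. -/
def bits (ω : Traffic) (t : ℕ) : ℕ → ℕ → List Bool
  | _, 0 => []
  | i, n + 1 => ω (i, t) :: bits ω t (i + 1) n

theorem measurableSet_bits (t i n : ℕ) (l : List Bool) :
    MeasurableSet ((fun ω => bits ω t i n) ⁻¹' {l}) := by
  induction n generalizing i l with
  | zero => exact MeasurableSet.const ([] = l)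
  | succ n ih =>
    cases l with
    | nil => convert MeasurableSet.empty; ext ω; simp [bits]
    | cons b l =>
      have : (fun ω => bits ω t i (n + 1)) ⁻¹' {b :: l} =
          {ω : Traffic | ω (i, t) = b} ∩ (fun ω => bits ω t (i + 1) n) ⁻¹' {l} := by
        ext ω; simp [bits]
      rw [this]
      exact (measurableSet_eq_fun (by fun_prop) (by fun_prop)).inter (ih (i + 1) l)

theorem measurable_comp_of_countable {Ω σ : Type*} [MeasurableSpace Ω] [Countable σ] {X : Ω → σ}
    (hX : ∀ x, MeasurableSet (X ⁻¹' {x})) (f : σ → ℝ≥0∞) : Measurable fun ω => f (X ω) := by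
  let _ : MeasurableSpace σ := ⊤
  exact (measurable_from_top (f := f)).comp (measurable_to_countable' hX)

theorem bits_update (ω : Traffic) (t i n j : ℕ) (hj : j < i) (b : Bool) :
    bits (Function.update ω (j, t) b) t i n = bits ω t i n := by
  induction n generalizing i with
  | zero => rfl
  | succ n ih =>
    have : ((i, t) : ℕ × ℕ) ≠ (j, t) := by simp only [ne_eq, Prod.mk.injEq]; omega
    rw [bits, bits, ih (i + 1) (by omega), Function.update_of_ne this]

/-- `X` does not see slot `t`, so the link states of that slot are fresh. They are resampled one
link at a time. -/
theorem lintegral_bits (p : unitInterval) {σ : Type*} [Countable σ] (X : Traffic → σ)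
    (hX : ∀ x, MeasurableSet (X ⁻¹' {x})) (t : ℕ)
    (hXt : ∀ ω j b, X (Function.update ω (j, t) b) = X ω) (i n : ℕ) (H : σ → List Bool → ℝ≥0∞) :
    ∫⁻ ω, H (X ω) (bits ω t i n) ∂(trafficMeasure p) =
      ∫⁻ ω, bitsMean p n (H (X ω)) ∂(trafficMeasure p) := by
  induction n generalizing i H with
  | zero => rfl
  | succ n ih =>
    have hXb : ∀ x : σ × List Bool,
        MeasurableSet ((fun ω => (X ω, bits ω t i (n + 1))) ⁻¹' {x}) := by
      intro x
      have : (fun ω => (X ω, bits ω t i (n + 1))) ⁻¹' {x} =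
          X ⁻¹' {x.1} ∩ (fun ω => bits ω t i (n + 1)) ⁻¹' {x.2} := by
        ext ω; simp [Prod.ext_iff]
      rw [this]
      exact (hX x.1).inter (measurableSet_bits t i (n + 1) x.2)
    rw [lintegral_traffic_resample p (i, t)
      (measurable_comp_of_countable hXb fun x => H x.1 x.2)]
    simp only [hXt, bits, bits_update _ t (i + 1) n i (Nat.lt_succ_self i), Function.update_self,
      bitsMean]
    have hXb' : ∀ x : σ × List Bool,
        MeasurableSet ((fun ω => (X ω, bits ω t (i + 1) n)) ⁻¹' {x}) := by
      intro x
      have : (fun ω => (X ω, bits ω t (i + 1) n)) ⁻¹' {x} =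
          X ⁻¹' {x.1} ∩ (fun ω => bits ω t (i + 1) n) ⁻¹' {x.2} := by
        ext ω; simp [Prod.ext_iff]
      rw [this]
      exact (hX x.1).inter (measurableSet_bits t (i + 1) n x.2)
    have hm1 := fun b => measurable_comp_of_countable hXb' fun x => H x.1 (b :: x.2)
    have hm2 := fun b => measurable_comp_of_countable hX fun x => bitsMean p n fun l => H x (b :: l)
    rw [lintegral_add_left ((hm1 true).const_mul _), lintegral_add_left ((hm2 true).const_mul _),
      lintegral_const_mul _ (hm1 true), lintegral_const_mul _ (hm1 false),
      lintegral_const_mul _ (hm2 true), lintegral_const_mul _ (hm2 false),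
      ih (i + 1) (fun x l => H x (true :: l)), ih (i + 1) (fun x l => H x (false :: l))]

/-! ### One slot of the queues, and the effect of an extra customer -/

/-- One slot of a tandem of queues with queue lengths `qs`, an arrival at the first queue if `a`,
and offered services `bs`: the new queue lengths, and whether a customer leaves the last queue. -/
def slotStep : List ℕ → Bool → List Bool → List ℕ × Bool
  | [], a, _ => ([], a)
  | q :: qs, a, [] => (q :: qs, a)
  | q :: qs, a, b :: bs =>
    ((q + a.toNat - (b && decide (0 < q)).toNat) :: (slotStep qs (b && decide (0 < q)) bs).1,
      (slotStep qs (b && decide (0 < q)) bs).2)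

/-- The expectation of `F` after one slot of a tandem of queues. -/
noncomputable def slotMean (p : unitInterval) :
    List ℕ → Bool → (List ℕ → Bool → ℝ≥0∞) → ℝ≥0∞
  | [], a, F => F [] a
  | q :: qs, a, F =>
    weight p true * slotMean p qs (decide (0 < q))
        (fun l => F ((q + a.toNat - (decide (0 < q)).toNat) :: l)) +
      weight p false * slotMean p qs false (fun l => F ((q + a.toNat) :: l))

section SlotMean

variable (p : unitInterval)

theorem slotMean_eq_bitsMean (qs : List ℕ) (a : Bool) (F : List ℕ → Bool → ℝ≥0∞) :
    slotMean p qs a F =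
      bitsMean p qs.length fun bs => F (slotStep qs a bs).1 (slotStep qs a bs).2 := by
  induction qs generalizing a F with
  | nil => rfl
  | cons q qs ih => simp [slotMean, bitsMean, slotStep, ih]

theorem slotMean_mono {F G : List ℕ → Bool → ℝ≥0∞} (h : ∀ l o, F l o ≤ G l o) (qs : List ℕ)
    (a : Bool) : slotMean p qs a F ≤ slotMean p qs a G := by
  induction qs generalizing a F G with
  | nil => exact h _ _
  | cons q qs ih =>
    simp only [slotMean]
    gcongr <;> exact ih (fun _ _ => h _ _) _

theorem slotMean_const_mul (x : ℝ≥0∞) (F : List ℕ → Bool → ℝ≥0∞) (qs : List ℕ) (a : Bool) :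
    slotMean p qs a (fun l o => x * F l o) = x * slotMean p qs a F := by
  induction qs generalizing a F with
  | nil => rfl
  | cons q qs ih =>
    simp only [slotMean]
    rw [ih, ih]
    ring

/-- The second list arises from the first by adding one customer to one queue. -/
inductive AddOne : List ℕ → List ℕ → Prop
  | head (q : ℕ) (qs : List ℕ) : AddOne (q :: qs) ((q + 1) :: qs)
  | tail (q : ℕ) {qs qs' : List ℕ} (h : AddOne qs qs') : AddOne (q :: qs) (q :: qs')

/-- An additional customer in the queues or in the output decreases the value of `F`, by a factor
of at least `x`. -/
structure SlowlyDecreasing (x : ℝ≥0∞) (F : List ℕ → Bool → ℝ≥0∞) : Prop where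
  queue : ∀ {qs qs'}, AddOne qs qs' → ∀ o, x * F qs o ≤ F qs' o ∧ F qs' o ≤ F qs o
  out : ∀ qs, x * F qs false ≤ F qs true ∧ F qs true ≤ F qs false

variable {p} {x : ℝ≥0∞} {F G : List ℕ → Bool → ℝ≥0∞}

theorem SlowlyDecreasing.cons (h : SlowlyDecreasing x F) (q : ℕ) :
    SlowlyDecreasing x fun l => F (q :: l) :=
  ⟨fun h' o => h.queue (h'.tail q) o, fun qs => h.out (q :: qs)⟩

theorem slotMean_between (h : ∀ l o, x * F l o ≤ G l o ∧ G l o ≤ F l o) (qs : List ℕ) (a : Bool) :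
    x * slotMean p qs a F ≤ slotMean p qs a G ∧ slotMean p qs a G ≤ slotMean p qs a F := by
  rw [← slotMean_const_mul]
  exact ⟨slotMean_mono p (fun l o => (h l o).1) qs a, slotMean_mono p (fun l o => (h l o).2) qs a⟩

theorem add_between {w w' A A' B B' : ℝ≥0∞} (h : x * A ≤ B ∧ B ≤ A) (h' : x * A' ≤ B' ∧ B' ≤ A') :
    x * (w * A + w' * A') ≤ w * B + w' * B' ∧ w * B + w' * B' ≤ w * A + w' * A' := by
  refine ⟨?_, by gcongr; exacts [h.2, h'.2]⟩
  calc x * (w * A + w' * A') = w * (x * A) + w' * (x * A') := by ring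
    _ ≤ _ := by gcongr; exacts [h.1, h'.1]

/-- Service looks at the queue before the arrival, so an extra arrival is not served in the same
slot: it is one more customer in the first queue afterwards. -/
theorem SlowlyDecreasing.slotMean_arrival (h : SlowlyDecreasing x F) (qs : List ℕ) :
    x * slotMean p qs false F ≤ slotMean p qs true F ∧
      slotMean p qs true F ≤ slotMean p qs false F := by
  cases qs with
  | nil => exact h.out []
  | cons q qs =>
    refine add_between (slotMean_between (fun l o => ?_) _ _)
      (slotMean_between (fun l o => h.queue (AddOne.head _ _) o) _ _)
    have : q + true.toNat - (decide (0 < q)).toNat =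
        q + false.toNat - (decide (0 < q)).toNat + 1 := by
      rcases q with _ | q <;> simp
    rw [this]
    exact h.queue (AddOne.head _ _) o

/-- Couple the two systems by using the same services. After the slot they still differ by exactly
one customer, in a queue or in the output. -/
theorem SlowlyDecreasing.slotMean (h : SlowlyDecreasing x F) :
    SlowlyDecreasing x fun qs a => slotMean p qs a F := by
  refine ⟨fun {qs qs'} h' a => ?_, h.slotMean_arrival⟩
  -- The extra customer leaves its queue only if that queue was otherwise empty and service is
  -- offered. It is then an extra arrival at the next queue; otherwise it stays.
  induction h' generalizing F a with
  | head q qs =>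
    refine add_between ?_ (slotMean_between (fun l o => ?_) _ _)
    · rcases q with _ | q
      · simpa using (h.cons a.toNat).slotMean_arrival qs
      · simp only [Nat.zero_lt_succ, decide_true]
        refine slotMean_between (fun l o => ?_) _ _
        have : q + 1 + 1 + a.toNat - true.toNat = q + 1 + a.toNat - true.toNat + 1 := by
          simp; omega
        rw [this]
        exact h.queue (AddOne.head _ _) o
    · rw [add_right_comm]
      exact h.queue (AddOne.head _ _) o
  | tail q _ ih => exact add_between (ih (h.cons _) _) (ih (h.cons _) _)

end SlotMean

/-! ### Stationary queues and Burke's theorem -/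

/-- The expectation of `f` over `n` independent queue lengths with law `π`. -/
noncomputable def queueMean (π : ℕ → ℝ≥0∞) : ℕ → (List ℕ → ℝ≥0∞) → ℝ≥0∞
  | 0, f => f []
  | n + 1, f => ∑' q, π q * queueMean π n fun l => f (q :: l)

section Burke

variable {p α : unitInterval} {π : ℕ → ℝ≥0∞}

theorem queueMean_mono {f g : List ℕ → ℝ≥0∞} (h : ∀ l, f l ≤ g l) (n : ℕ) :
    queueMean π n f ≤ queueMean π n g := by
  induction n generalizing f g with
  | zero => exact h _
  | succ n ih => exact ENNReal.tsum_le_tsum fun q => by gcongr; exact ih fun l => h _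

theorem queueMean_const_mul (c : ℝ≥0∞) (f : List ℕ → ℝ≥0∞) (n : ℕ) :
    queueMean π n (fun l => c * f l) = c * queueMean π n f := by
  induction n generalizing f with
  | zero => rfl
  | succ n ih =>
    simp only [queueMean, ih, ← ENNReal.tsum_mul_left]
    exact tsum_congr fun q => by ring

theorem queueMean_add (f g : List ℕ → ℝ≥0∞) (n : ℕ) :
    queueMean π n (fun l => f l + g l) = queueMean π n f + queueMean π n g := by
  induction n generalizing f g with
  | zero => rfl
  | succ n ih => simp only [queueMean, ih, mul_add, ENNReal.tsum_add]

theorem queueMean_one_le (hπ : ∑' q, π q ≤ 1) (n : ℕ) : queueMean π n (fun _ => 1) ≤ 1 := by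
  induction n with
  | zero => exact le_rfl
  | succ n ih =>
    refine le_trans (ENNReal.tsum_le_tsum fun q => mul_le_of_le_one_right' ih) hπ

/-- Filling an empty queue with `q` customers costs at most a factor `x ^ q`; averaging over `π`
compares the empty start with the stationary one. -/
theorem mul_pow_le_queueMean {x : ℝ≥0∞} {f : List ℕ → ℝ≥0∞}
    (hf : ∀ qs qs', AddOne qs qs' → x * f qs ≤ f qs') (n : ℕ) :
    f (List.replicate n 0) * (∑' q, π q * x ^ q) ^ n ≤ queueMean π n f := by
  induction n generalizing f with
  | zero => simp [queueMean]
  | succ n ih =>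
    have hq : ∀ q l, x ^ q * f (0 :: l) ≤ f (q :: l) := by
      intro q l
      induction q with
      | zero => simp
      | succ q ihq =>
        calc x ^ (q + 1) * f (0 :: l) = x * (x ^ q * f (0 :: l)) := by ring
          _ ≤ x * f (q :: l) := by gcongr
          _ ≤ f ((q + 1) :: l) := hf _ _ (AddOne.head q l)
    calc f (List.replicate (n + 1) 0) * (∑' q, π q * x ^ q) ^ (n + 1)
        = (∑' q, π q * x ^ q) * (f (0 :: List.replicate n 0) * (∑' q, π q * x ^ q) ^ n) := by
          rw [List.replicate_succ]; ring
      _ = ∑' q, π q * x ^ q * (f (0 :: List.replicate n 0) * (∑' q, π q * x ^ q) ^ n) := by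
          rw [ENNReal.tsum_mul_right]
      _ ≤ queueMean π (n + 1) f := by
          refine ENNReal.tsum_le_tsum fun q => ?_
          calc π q * x ^ q * (f (0 :: List.replicate n 0) * (∑' q, π q * x ^ q) ^ n)
              = π q * ((x ^ q * f (0 :: List.replicate n 0)) * (∑' q, π q * x ^ q) ^ n) := by ring
            _ ≤ π q * (f (q :: List.replicate n 0) * (∑' q, π q * x ^ q) ^ n) := by
              gcongr; exact hq _ _
            _ ≤ _ := by
              gcongr
              exact ih fun qs qs' h => hf _ _ (h.tail q)

/-- The law `π` is reversible for the length of a queue with arrivals of rate `α` and service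
of rate `p`. -/
structure Balanced (p α : unitInterval) (π : ℕ → ℝ≥0∞) : Prop where
  zero : π 0 * weight α true = π 1 * (weight α false * weight p true)
  succ : ∀ q, π (q + 1) * (weight α true * weight p false) =
    π (q + 2) * (weight α false * weight p true)

/-- Burke's theorem for one slot of one queue: the new queue length and the output are independent
and have the laws of the old queue length and the input. -/
theorem Balanced.burke_one (h : Balanced p α π) (G : ℕ → Bool → ℝ≥0∞) :
    ∑' q, π q * (weight α true * (weight p true * G (q + true.toNat - (decide (0 < q)).toNat)
          (decide (0 < q)) + weight p false * G (q + true.toNat) false) +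
        weight α false * (weight p true * G (q + false.toNat - (decide (0 < q)).toNat)
          (decide (0 < q)) + weight p false * G (q + false.toNat) false)) =
      ∑' q, π q * (weight α true * G q true + weight α false * G q false) := by
  have hp := weight_add p
  have h0 := h.zero
  have h1 := h.succ
  rw [tsum_eq_zero_add' ENNReal.summable, tsum_eq_zero_add' ENNReal.summable (f := fun q =>
    π q * (weight α true * G q true + weight α false * G q false))]
  generalize weight α true = a at *
  generalize weight α false = a' at *
  generalize weight p true = b at *
  generalize weight p false = b' at *
  -- Detailed balance trades a down-step (no arrival, a service) for the reverse up-step. `e1` does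
  -- this for slots with output, `e2` for the terms without.
  have e1 : ∑' q, π (q + 1) * (a' * b) * G q true =
      π 0 * a * G 0 true + ∑' q, π (q + 1) * (a * b') * G (q + 1) true := by
    rw [tsum_eq_zero_add' ENNReal.summable, h0]
    simp only [h1]
  have e2 : ∑' q, π (q + 1) * (a' * b) * G (q + 1) false =
      π 0 * a * G 1 false + ∑' q, π (q + 1) * (a * b') * G (q + 2) false := by
    rw [tsum_eq_zero_add' ENNReal.summable, h0]
    simp only [h1]
  have e3 : ∀ q, π (q + 1) * (a * (b * G (q + 1) true + b' * G (q + 2) false) +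
      a' * (b * G q true + b' * G (q + 1) false)) =
      π (q + 1) * (a * b) * G (q + 1) true + π (q + 1) * (a * b') * G (q + 2) false +
      (π (q + 1) * (a' * b) * G q true + π (q + 1) * (a' * b') * G (q + 1) false) :=
    fun q => by ring
  have e4 : ∀ q, π (q + 1) * (a * G (q + 1) true + a' * G (q + 1) false) =
      π (q + 1) * (a * b) * G (q + 1) true + π (q + 1) * (a * b') * G (q + 1) true +
      (π (q + 1) * (a' * b) * G (q + 1) false + π (q + 1) * (a' * b') * G (q + 1) false) := by
    intro q
    calc _ = π (q + 1) * (a * (b + b') * G (q + 1) true + a' * (b + b') * G (q + 1) false) := by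
          rw [hp, mul_one, mul_one]
      _ = _ := by ring
  have e5 : π 0 * (a * (b * G 1 false + b' * G 1 false) + a' * (b * G 0 false + b' * G 0 false)) =
      π 0 * a * G 1 false + π 0 * a' * G 0 false := by
    rw [← add_mul, ← add_mul, hp]; ring
  simp only [Nat.zero_lt_succ, decide_true, decide_false, lt_irrefl, Bool.toNat_true,
    Bool.toNat_false, add_tsub_cancel_right, add_zero, zero_add, tsub_zero, e4]
  simp only [add_assoc, Nat.reduceAdd] at *
  simp only [e3, e5, ENNReal.tsum_add, e1, e2]
  ring

/-- The output of the first queue is again Bernoulli of rate `α` and independent of its new length,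
so it serves as input for the remaining queues. -/
theorem Balanced.burke (h : Balanced p α π) (n : ℕ) (F : List ℕ → Bool → ℝ≥0∞) :
    queueMean π n (fun qs => weight α true * slotMean p qs true F +
        weight α false * slotMean p qs false F) =
      queueMean π n fun qs => weight α true * F qs true + weight α false * F qs false := by
  induction n generalizing F with
  | zero => rfl
  | succ n ih =>
    have := h.burke_one fun c d => queueMean π n fun qs => slotMean p qs d fun l => F (c :: l)
    simp only [queueMean, slotMean, queueMean_add, queueMean_const_mul] at this ⊢
    rw [this]
    refine tsum_congr fun q => ?_
    have := ih fun l => F (q :: l)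
    simp only [queueMean_add, queueMean_const_mul] at this
    rw [this]

end Burke

/-! ### The queue lengths of the tandem as a Markov chain -/

theorem tandem_congr {ω ω' : Traffic} (i t : ℕ) (h : ∀ j, ∀ s < t, ω (j, s) = ω' (j, s)) :
    tandem ω i t = tandem ω' i t := by
  induction t generalizing i with
  | zero => simp
  | succ t ih =>
    have ih := fun i => ih i fun j s hs => h j s (hs.trans t.lt_succ_self)
    cases i with
    | zero => rw [tandem_zero_succ, tandem_zero_succ, ih, h 0 t t.lt_succ_self]
    | succ i => rw [tandem_succ_succ, tandem_succ_succ, ih, ih, h (i + 1) t t.lt_succ_self]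

theorem tandem_update (ω : Traffic) (i t j : ℕ) (b : Bool) :
    tandem (Function.update ω (j, t) b) i t = tandem ω i t := by
  refine tandem_congr i t fun j' s hs => Function.update_of_ne ?_ _ _
  simp only [ne_eq, Prod.mk.injEq]; omega

theorem measurable_tandem (i t : ℕ) : Measurable fun ω => tandem ω i t := by
  induction t generalizing i with
  | zero => simp
  | succ t ih =>
    cases i with
    | zero =>
      simp only [tandem_zero_succ]
      refine (ih 0).add (Measurable.ite ?_ measurable_const measurable_const)
      exact measurableSet_eq_fun (by fun_prop) (by fun_prop)
    | succ i =>
      simp only [tandem_succ_succ]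
      refine (ih (i + 1)).add (Measurable.ite (MeasurableSet.inter ?_ ?_)
        measurable_const measurable_const)
      · exact measurableSet_eq_fun (by fun_prop) (by fun_prop)
      · exact measurableSet_lt (ih (i + 1)) (ih i)

/-- The lengths of the `n` queues between servers `i` and `i + n` at the beginning of slot `t`. -/
def queues (ω : Traffic) (t : ℕ) : ℕ → ℕ → List ℕ
  | _, 0 => []
  | i, n + 1 => (tandem ω i t - tandem ω (i + 1) t) :: queues ω t (i + 1) n

@[simp] theorem length_queues (ω : Traffic) (t i n : ℕ) : (queues ω t i n).length = n := by
  induction n generalizing i with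
  | zero => rfl
  | succ n ih => simp [queues, ih]

theorem queues_zero (ω : Traffic) (i n : ℕ) : queues ω 0 i n = List.replicate n 0 := by
  induction n generalizing i with
  | zero => rfl
  | succ n ih => simp [queues, ih, List.replicate_succ]

theorem queues_update (ω : Traffic) (t i n j : ℕ) (b : Bool) :
    queues (Function.update ω (j, t) b) t i n = queues ω t i n := by
  induction n generalizing i with
  | zero => rfl
  | succ n ih => rw [queues, queues, tandem_update, tandem_update, ih]

theorem measurableSet_queues (t i n : ℕ) (l : List ℕ) :
    MeasurableSet ((fun ω => queues ω t i n) ⁻¹' {l}) := by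
  induction n generalizing i l with
  | zero => exact MeasurableSet.const ([] = l)
  | succ n ih =>
    cases l with
    | nil => convert MeasurableSet.empty; ext ω; simp [queues]
    | cons q l =>
      have : (fun ω => queues ω t i (n + 1)) ⁻¹' {q :: l} =
          {ω : Traffic | tandem ω i t - tandem ω (i + 1) t = q} ∩
            (fun ω => queues ω t (i + 1) n) ⁻¹' {l} := by
        ext ω; simp [queues]
      rw [this]
      exact (measurableSet_eq_fun ((measurable_tandem i t).sub (measurable_tandem (i + 1) t))
        measurable_const).inter (ih (i + 1) l)

/-- The tandem of queues evolves by `slotStep`. -/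
theorem slotStep_queues (ω : Traffic) (t i n : ℕ) (a : Bool)
    (ha : tandem ω i (t + 1) = tandem ω i t + a.toNat) :
    (slotStep (queues ω t i n) a (bits ω t (i + 1) n)).1 = queues ω (t + 1) i n ∧
      tandem ω (i + n) (t + 1) = tandem ω (i + n) t +
        (slotStep (queues ω t i n) a (bits ω t (i + 1) n)).2.toNat := by
  induction n generalizing i a with
  | zero => exact ⟨rfl, ha⟩
  | succ n ih =>
    simp only [queues, bits, slotStep]
    set d : Bool := ω (i + 1, t) && decide (0 < tandem ω i t - tandem ω (i + 1) t) with hd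
    have hstep : tandem ω (i + 1) (t + 1) = tandem ω (i + 1) t + d.toNat := by
      rw [tandem_succ_succ, hd]
      by_cases h1 : ω (i + 1, t) = true <;>
        by_cases h2 : tandem ω (i + 1) t < tandem ω i t <;> simp [h1, h2]
    obtain ⟨h1, h2⟩ := ih (i + 1) d hstep
    rw [h1]
    refine ⟨?_, ?_⟩
    · congr 1
      have := tandem_succ_le ω i t
      rw [hstep, ha]
      omega
    · rw [← add_assoc, add_right_comm i n 1]
      exact h2

/-! ### Exponential moment of the departures -/

section Mean

variable {p α : unitInterval} {x : ℝ≥0∞} {π : ℕ → ℝ≥0∞}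

/-- The expectation of `f` after one slot of the tandem of queues with a saturated first server,
where every customer who leaves costs a factor `x`. -/
noncomputable def tilted (p : unitInterval) (x : ℝ≥0∞) (f : List ℕ → ℝ≥0∞) (qs : List ℕ) : ℝ≥0∞ :=
  weight p true * slotMean p qs true (fun l o => x ^ o.toNat * f l) +
    weight p false * slotMean p qs false (fun l o => x ^ o.toNat * f l)

/-- Queue lengths and departures before slot `t` are independent of the services of slot `t`: this
is the Markov property, which moves one slot from the measure to the operator `tilted`. -/
theorem lintegral_tilted (n t : ℕ) (f : List ℕ → ℝ≥0∞) :
    ∫⁻ ω, x ^ tandem ω n (t + 1) * f (queues ω (t + 1) 0 n) ∂(trafficMeasure p) =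
      ∫⁻ ω, x ^ tandem ω n t * tilted p x f (queues ω t 0 n) ∂(trafficMeasure p) := by
  have hX : ∀ y : List ℕ × ℕ,
      MeasurableSet ((fun ω => (queues ω t 0 n, tandem ω n t)) ⁻¹' {y}) := by
    intro y
    have : (fun ω => (queues ω t 0 n, tandem ω n t)) ⁻¹' {y} =
        (fun ω => queues ω t 0 n) ⁻¹' {y.1} ∩ {ω | tandem ω n t = y.2} := by
      ext ω; simp [Prod.ext_iff]
    rw [this]
    exact (measurableSet_queues t 0 n y.1).inter
      (measurableSet_eq_fun (measurable_tandem n t) measurable_const)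
  -- There are `n + 1` bits: the head, from the saturated server 0, is the arrival at the first
  -- queue, and the tail holds the services of the `n` queues.
  have key := lintegral_bits p (fun ω => (queues ω t 0 n, tandem ω n t)) hX t
    (fun ω j b => by simp only [queues_update, tandem_update]) 0 (n + 1)
    fun y bs => x ^ (y.2 + (slotStep y.1 (bs.headD false) bs.tail).2.toNat) *
      f (slotStep y.1 (bs.headD false) bs.tail).1
  calc _ = _ := lintegral_congr fun ω => by
        have ha : tandem ω 0 (t + 1) = tandem ω 0 t + (ω (0, t)).toNat := by
          rw [tandem_zero_succ]; cases ω (0, t) <;> simp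
        obtain ⟨h1, h2⟩ := slotStep_queues ω t 0 n _ ha
        rw [← h1]
        rw [zero_add] at h2
        rw [h2]
        rfl
    _ = _ := key
    _ = _ := lintegral_congr fun ω => by
        have hmul : ∀ a, bitsMean p n (fun l => x ^ (tandem ω n t +
            (slotStep (queues ω t 0 n) a l).2.toNat) * f (slotStep (queues ω t 0 n) a l).1) =
            x ^ tandem ω n t * slotMean p (queues ω t 0 n) a fun l o => x ^ o.toNat * f l := by
          intro a
          rw [← slotMean_const_mul, slotMean_eq_bitsMean, length_queues]
          simp only [pow_add, mul_assoc]
        simp only [bitsMean, List.headD_cons, List.tail_cons, hmul, tilted]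
        ring

theorem lintegral_pow_tandem (n N : ℕ) :
    ∫⁻ ω, x ^ tandem ω n N ∂(trafficMeasure p) =
      ((tilted p x)^[N] fun _ => 1) (List.replicate n 0) := by
  have h : ∀ t (f : List ℕ → ℝ≥0∞),
      ∫⁻ ω, x ^ tandem ω n t * f (queues ω t 0 n) ∂(trafficMeasure p) =
        ((tilted p x)^[t] f) (List.replicate n 0) := by
    intro t
    induction t with
    | zero => intro f; simp [queues_zero]
    | succ t ih => intro f; rw [lintegral_tilted, ih, Function.iterate_succ_apply]
  simpa using h N fun _ => 1

theorem slowlyDecreasing_pow_mul (hx : x ≤ 1) {f : List ℕ → ℝ≥0∞}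
    (hf : ∀ {qs qs'}, AddOne qs qs' → x * f qs ≤ f qs' ∧ f qs' ≤ f qs) :
    SlowlyDecreasing x fun l o => x ^ o.toNat * f l := by
  refine ⟨fun h o => ⟨?_, ?_⟩, fun qs => ?_⟩
  · rw [mul_left_comm]; gcongr; exact (hf h).1
  · gcongr; exact (hf h).2
  · simpa using mul_le_of_le_one_left' hx

/-- One extra initial customer produces at most one extra departure, and never fewer; each departure
weighs `x`. -/
theorem tilted_iterate_between (hx : x ≤ 1) (N : ℕ) : ∀ {qs qs'}, AddOne qs qs' →
    x * ((tilted p x)^[N] fun _ => 1) qs ≤ ((tilted p x)^[N] fun _ => 1) qs' ∧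
      ((tilted p x)^[N] fun _ => 1) qs' ≤ ((tilted p x)^[N] fun _ => 1) qs := by
  induction N with
  | zero => intro _ _ _; simpa using hx
  | succ N ih =>
    intro qs qs' h
    simp only [Function.iterate_succ_apply']
    have hs := (slowlyDecreasing_pow_mul hx ih).slotMean (p := p)
    exact add_between (hs.queue h true) (hs.queue h false)

theorem weight_mix_le (hα : α ≤ p) {u v : ℝ≥0∞} (h : u ≤ v) :
    weight p true * u + weight p false * v ≤ weight α true * u + weight α false * v := by
  have h1 : weight p true = weight α true + ENNReal.ofReal (p - α) := by
    simp only [weight, if_true]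
    rw [← ENNReal.ofReal_add α.2.1 (sub_nonneg.2 hα)]; simp
  have h2 : weight α false = weight p false + ENNReal.ofReal (p - α) := by
    simp only [weight, Bool.false_eq_true, if_false]
    rw [← ENNReal.ofReal_add (sub_nonneg.2 p.2.2) (sub_nonneg.2 hα)]; simp
  rw [h1, h2]
  calc _ = weight α true * u + weight p false * v + ENNReal.ofReal (p - α) * u := by ring
    _ ≤ weight α true * u + weight p false * v + ENNReal.ofReal (p - α) * v := by gcongr
    _ = _ := by ring

/-- Lowering the arrival rate from `p` to `α` can only raise the moment, as arrivals decrease it. At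
rate `α` the law `π` is stationary, and Burke's theorem splits off one factor per slot. -/
theorem queueMean_tilted_le (hx : x ≤ 1) (hα : α ≤ p) (hπ : Balanced p α π)
    (hπ1 : ∑' q, π q ≤ 1) (n N : ℕ) :
    queueMean π n ((tilted p x)^[N] fun _ => 1) ≤ (weight α true * x + weight α false) ^ N := by
  induction N with
  | zero => simpa using queueMean_one_le hπ1 n
  | succ N ih =>
    simp only [Function.iterate_succ_apply']
    set f := (tilted p x)^[N] fun _ => 1
    have hs := (slowlyDecreasing_pow_mul hx (tilted_iterate_between (p := p) hx N)).slotMean (p := p)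
    calc queueMean π n (tilted p x f)
        ≤ queueMean π n (fun qs => weight α true * slotMean p qs true (fun l o => x ^ o.toNat * f l)
          + weight α false * slotMean p qs false (fun l o => x ^ o.toNat * f l)) :=
          queueMean_mono (fun qs => weight_mix_le hα (hs.out qs).2) n
      _ = (weight α true * x + weight α false) * queueMean π n f := by
          rw [hπ.burke, ← queueMean_const_mul]
          congr 1
          funext qs
          simp
          ring
      _ ≤ _ := by rw [pow_succ']; gcongr

/-- The exponential moment of the number of departures from a tandem of `n + 1` queues. -/
theorem lintegral_pow_tandem_mul_le (hx : x ≤ 1) (hα : α ≤ p) (hπ : Balanced p α π)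
    (hπ1 : ∑' q, π q ≤ 1) (n N : ℕ) :
    (∫⁻ ω, x ^ tandem ω n N ∂(trafficMeasure p)) * (∑' q, π q * x ^ q) ^ n ≤
      (weight α true * x + weight α false) ^ N := by
  rw [lintegral_pow_tandem]
  exact (mul_pow_le_queueMean (fun qs qs' h => (tilted_iterate_between hx N h).1) n).trans
    (queueMean_tilted_le hx hα hπ hπ1 n N)

theorem measure_tandem_lt_mul_le (hx : x ≤ 1) (hα : α ≤ p) (hπ : Balanced p α π)
    (hπ1 : ∑' q, π q ≤ 1) (n N θ : ℕ) :
    trafficMeasure p {ω | tandem ω n N < θ} * x ^ θ * (∑' q, π q * x ^ q) ^ n ≤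
      (weight α true * x + weight α false) ^ N := by
  refine le_trans ?_ (lintegral_pow_tandem_mul_le hx hα hπ hπ1 n N)
  gcongr
  rw [mul_comm]
  have hm : Measurable fun ω => x ^ tandem ω n N :=
    (measurable_from_top (f := fun m : ℕ => x ^ m)).comp (measurable_tandem n N)
  refine le_trans ?_ (mul_meas_ge_le_lintegral hm (x ^ θ))
  gcongr with ω
  exact fun h => pow_le_pow_right_of_le_one' hx h.le

end Mean

/-! ### From failure probabilities to the average delay -/

section Delay

variable {k : ℕ}

/-- Every `N` below the delay is a failure and contributes 1; if decoding never happens, both sides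
are infinite. -/
theorem codingDelay_le_tsum (L : ℕ) (c : Code k) (ω : Traffic) :
    codingDelay (L + 1) c ω ≤
      ∑' N, (notSpanning k (L + 1) N).indicator (fun _ => (1 : ℝ≥0∞)) (c, ω) := by
  classical
  have hone : ∀ N, Set.finrank (ZMod 2) (received (L + 1) c ω N) ≠ k →
      (notSpanning k (L + 1) N).indicator (fun _ => (1 : ℝ≥0∞)) (c, ω) = 1 := fun N hN =>
    Set.indicator_of_mem (show (c, ω) ∈ notSpanning k (L + 1) N from
      exists_not_hit_of_finrank_ne ω hN) _
  by_cases hex : ∃ N, Set.finrank (ZMod 2) (received (L + 1) c ω N) = k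
  · refine (iInf₂_le (Nat.find hex) (Nat.find_spec hex)).trans ?_
    calc (Nat.find hex : ℝ≥0∞) = ∑ N ∈ Finset.range (Nat.find hex),
          (notSpanning k (L + 1) N).indicator (fun _ => (1 : ℝ≥0∞)) (c, ω) := by
          rw [Finset.sum_congr rfl fun N hN =>
            hone N (Nat.find_min hex (Finset.mem_range.1 hN))]
          simp
      _ ≤ _ := ENNReal.sum_le_tsum _
  · push Not at hex
    simp [hone _ (hex _)]

theorem averageCodingDelay_le_tsum (L : ℕ) (p : unitInterval) (c : Code k) :
    averageCodingDelay (L + 1) p c ≤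
      ∑' N, trafficMeasure p {ω | (c, ω) ∈ notSpanning k (L + 1) N} := by
  refine (lintegral_mono fun ω => codingDelay_le_tsum L c ω).trans_eq ?_
  have hm : ∀ N, MeasurableSet {ω | (c, ω) ∈ notSpanning k (L + 1) N} := fun N =>
    (measurableSet_notSpanning k (L + 1) N).preimage (measurable_const.prodMk measurable_id)
  have : ∀ N, (fun ω => (notSpanning k (L + 1) N).indicator (fun _ => (1 : ℝ≥0∞)) (c, ω)) =
      {ω | (c, ω) ∈ notSpanning k (L + 1) N}.indicator fun _ => 1 := fun N => rfl
  rw [lintegral_tsum fun N => by rw [this]; exact (measurable_const.indicator (hm N)).aemeasurable]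
  refine tsum_congr fun N => ?_
  rw [this, lintegral_indicator (hm N), setLIntegral_one]

/-- If the tandem of queues is usually fast, the average coding delay is small for most codes. -/
theorem measure_lt_averageCodingDelay_le (L : ℕ) (p : unitInterval) (θ : ℕ → ℕ) :
    codeMeasure k {c | ∑' N, trafficMeasure p {ω | tandem ω L N < θ N} + 1 <
        averageCodingDelay (L + 1) p c} ≤
      ∑' N : ℕ, (2 : ℝ≥0∞) ^ k * ((N + 1 : ℕ) ^ (L + 1) * 2⁻¹ ^ θ N) := by
  -- Failures despite enough departures. The remaining failures are charged to the traffic alone,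
  -- uniformly in the code.
  set B : ℕ → Set (Code k × Traffic) := fun N =>
    notSpanning k (L + 1) N ∩ {x | θ N ≤ tandem x.2 L N} with hB
  have hBm : ∀ N, MeasurableSet (B N) := fun N => (measurableSet_notSpanning k (L + 1) N).inter
    (measurableSet_le measurable_const ((measurable_tandem L N).comp measurable_snd))
  set R : Code k → ℝ≥0∞ := fun c => ∑' N, trafficMeasure p (Prod.mk c ⁻¹' B N) with hR
  have hRm : Measurable R := Measurable.tsum fun N => measurable_measure_prodMk_left (hBm N)
  have havg : ∀ c, averageCodingDelay (L + 1) p c ≤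
      ∑' N, trafficMeasure p {ω | tandem ω L N < θ N} + R c := by
    intro c
    refine (averageCodingDelay_le_tsum L p c).trans ?_
    rw [hR, ← ENNReal.tsum_add]
    refine ENNReal.tsum_le_tsum fun N => (measure_mono fun ω hω => ?_).trans (measure_union_le _ _)
    by_cases h : tandem ω L N < θ N
    · exact Or.inl h
    · exact Or.inr ⟨hω, not_lt.1 h⟩
  have hRint : ∫⁻ c, R c ∂(codeMeasure k) ≤
      ∑' N : ℕ, (2 : ℝ≥0∞) ^ k * ((N + 1 : ℕ) ^ (L + 1) * 2⁻¹ ^ θ N) := by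
    rw [hR, lintegral_tsum fun N => (measurable_measure_prodMk_left (hBm N)).aemeasurable]
    refine ENNReal.tsum_le_tsum fun N => ?_
    rw [← Measure.prod_apply (hBm N), Measure.prod_apply_symm (hBm N)]
    calc _ ≤ ∫⁻ _ω, (2 : ℝ≥0∞) ^ k * ((N + 1 : ℕ) ^ (L + 1) * 2⁻¹ ^ θ N) ∂(trafficMeasure p) := by
          refine lintegral_mono fun ω => ?_
          by_cases h : θ N ≤ tandem ω L N
          · refine (measure_mono fun c hc => hc.1).trans
              ((measure_notSpanning_le ω L N).trans ?_)
            gcongr _ * (_ * ?_)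
            exact pow_le_pow_right_of_le_one' (by simp) h
          · have : (fun c => (c, ω)) ⁻¹' B N = ∅ := by
              ext c; simpa [hB] using fun _ => not_le.1 h
            simp [this]
      _ = _ := by simp
  -- Markov's inequality at level 1: the random part exceeds the additional slot only with the
  -- allowed probability.
  have hmarkov := (mul_meas_ge_le_lintegral hRm 1).trans hRint
  rw [one_mul] at hmarkov
  refine le_trans (measure_mono fun c hc => ?_) hmarkov
  by_contra h
  exact absurd (hc.trans_le (havg c)) (not_lt.2 (by gcongr; exact (not_le.1 h).le))

theorem constrainedAverageCodingDelay_le (L : ℕ) (p : unitInterval) (ε : ℝ) (θ : ℕ → ℕ) (M : ℤ)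
    (hM : ∑' N, trafficMeasure p {ω | tandem ω L N < θ N} + 1 ≤ ENNReal.ofReal M)
    (hθ : ∑' N : ℕ, (2 : ℝ≥0∞) ^ k * ((N + 1 : ℕ) ^ (L + 1) * 2⁻¹ ^ θ N) ≤ ENNReal.ofReal ε) :
    constrainedAverageCodingDelay k (L + 1) p ε ≤ ((M : ℝ) : EReal) := by
  refine (iInf_le _ M).trans (iInf_le _ (le_trans (measure_mono fun c hc => ?_)
    ((measure_lt_averageCodingDelay_le L p θ).trans hθ)))
  have hM0 : 0 ≤ (M : ℝ) := by
    by_contra h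
    rw [ENNReal.ofReal_of_nonpos (not_le.1 h).le] at hM
    simp at hM
  refine hM.trans_lt ?_
  rw [Set.mem_ofPred_eq] at hc
  rw [← EReal.coe_ennreal_lt_coe_ennreal_iff, EReal.coe_ennreal_ofReal, max_eq_left hM0]
  exact hc

end Delay

/-! ### The stationary law and the large deviation bound -/

/-- The stationary law of the length of a queue with service rate `p` and arrivals of rate
`p / (1 + σ)`. -/
noncomputable def stationaryLaw (p σ : ℝ) : ℕ → ℝ
  | 0 => σ / (1 + σ)
  | q + 1 => σ / ((1 + σ) * (1 + σ - p)) * ((1 - p) / (1 + σ - p)) ^ q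

section Stationary

variable {p : unitInterval} {σ : ℝ}

theorem stationaryLaw_nonneg (hσ : 0 < σ) (q : ℕ) : 0 ≤ stationaryLaw p σ q := by
  have h1 : 0 ≤ 1 - (p : ℝ) := sub_nonneg.2 p.2.2
  have h2 : 0 < 1 + σ - (p : ℝ) := by linarith
  cases q <;> simp only [stationaryLaw] <;> positivity

theorem hasSum_stationaryLaw_mul_pow (hσ : 0 < σ) {x : ℝ} (hx0 : 0 < x) (hx1 : x ≤ 1) :
    HasSum (fun q => stationaryLaw p σ q * x ^ q) (σ / ((1 + σ) * (1 + σ - (p : ℝ))) * x *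
      (1 - (1 - (p : ℝ)) / (1 + σ - (p : ℝ)) * x)⁻¹ + σ / (1 + σ)) := by
  have h1 : 0 ≤ 1 - (p : ℝ) := sub_nonneg.2 p.2.2
  have h2 : 0 < 1 + σ - (p : ℝ) := by linarith
  have hρ0 : 0 ≤ (1 - (p : ℝ)) / (1 + σ - p) := by positivity
  have hρ : (1 - (p : ℝ)) / (1 + σ - p) < 1 := by rw [div_lt_one h2]; linarith
  have hg := (hasSum_geometric_of_lt_one (r := (1 - (p : ℝ)) / (1 + σ - p) * x) (by positivity)
    (by nlinarith)).mul_left (σ / ((1 + σ) * (1 + σ - p)) * x)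
  have hshift : (fun i => σ / ((1 + σ) * (1 + σ - (p : ℝ))) * x *
      ((1 - (p : ℝ)) / (1 + σ - p) * x) ^ i) = fun q => stationaryLaw p σ (q + 1) * x ^ (q + 1) := by
    funext q
    simp only [stationaryLaw, mul_pow]
    ring
  rw [hshift] at hg
  have := (hasSum_nat_add_iff (f := fun q => stationaryLaw p σ q * x ^ q) 1).1 hg
  simpa [stationaryLaw] using this

theorem tsum_stationaryLaw (hσ : 0 < σ) :
    ∑' q, ENNReal.ofReal (stationaryLaw p σ q) = 1 := by
  have h2 : 0 < 1 + σ - (p : ℝ) := by linarith [p.2.2]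
  have := hasSum_stationaryLaw_mul_pow (p := p) hσ one_pos le_rfl
  simp only [one_pow, mul_one] at this
  rw [← ENNReal.ofReal_tsum_of_nonneg (stationaryLaw_nonneg hσ) this.summable, this.tsum_eq]
  rw [← ENNReal.ofReal_one]
  congr 1
  have h3 : 1 - (1 - (p : ℝ)) / (1 + σ - p) = σ / (1 + σ - p) := by field_simp; ring
  rw [h3]
  field_simp

/-- At `x = 1 / (1 + σ)` the sum over positive lengths is `1 / ((1 + σ) * (2 + σ - p))`, and this
denominator is at most `2 * 3`. So the start-up cost per queue stays bounded as `σ → 0`. -/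
theorem le_tsum_stationaryLaw (hσ : 0 < σ) (hσ1 : σ ≤ 1) :
    ENNReal.ofReal (1 / 6) ≤
      ∑' q, ENNReal.ofReal (stationaryLaw p σ q) * ENNReal.ofReal (1 / (1 + σ)) ^ q := by
  have hp1 := p.2.2
  have hp0 := p.2.1
  have h2 : 0 < 1 + σ - (p : ℝ) := by linarith
  have h0 := stationaryLaw_nonneg (p := p) hσ
  have hx : 0 < 1 / (1 + σ) := by positivity
  have := hasSum_stationaryLaw_mul_pow (p := p) hσ hx (by rw [div_le_one] <;> linarith)
  simp only [← ENNReal.ofReal_pow hx.le, ← ENNReal.ofReal_mul (h0 _)]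
  rw [← ENNReal.ofReal_tsum_of_nonneg (fun q => mul_nonneg (h0 q) (by positivity)) this.summable,
    this.tsum_eq]
  refine ENNReal.ofReal_le_ofReal ?_
  have h3 : 1 - (1 - (p : ℝ)) / (1 + σ - p) * (1 / (1 + σ)) =
      σ * (2 + σ - p) / ((1 + σ - p) * (1 + σ)) := by field_simp; ring
  have h4 : 0 < 2 + σ - (p : ℝ) := by linarith
  have h5 : σ / ((1 + σ) * (1 + σ - p)) * (1 / (1 + σ)) *
      (σ * (2 + σ - p) / ((1 + σ - p) * (1 + σ)))⁻¹ = 1 / ((1 + σ) * (2 + σ - p)) := by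
    field_simp
  rw [h3, h5]
  have h6 : (1 + σ) * (2 + σ - p) ≤ 6 := by nlinarith
  have h7 : (1 : ℝ) / 6 ≤ 1 / ((1 + σ) * (2 + σ - p)) :=
    one_div_le_one_div_of_le (by positivity) h6
  have h8 : 0 ≤ σ / (1 + σ) := by positivity
  linarith

theorem balanced_stationaryLaw {α : unitInterval} (hp : 0 < p) (hσ : 0 < σ)
    (hα : (α : ℝ) = p / (1 + σ)) :
    Balanced p α fun q => ENNReal.ofReal (stationaryLaw p σ q) := by
  have hp1 := p.2.2
  have hp0 : 0 < (p : ℝ) := hp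
  have h2 : 0 < 1 + σ - (p : ℝ) := by linarith
  have h0 := stationaryLaw_nonneg (p := p) hσ
  have hα' : 1 - (α : ℝ) = (1 + σ - p) / (1 + σ) := by rw [hα]; field_simp
  have hα0 := α.2.1
  have hα1 : 0 ≤ 1 - (α : ℝ) := sub_nonneg.2 α.2.2
  constructor
  · simp only [weight, if_true, Bool.false_eq_true, if_false]
    rw [← ENNReal.ofReal_mul hα1, ← ENNReal.ofReal_mul (h0 _), ← ENNReal.ofReal_mul (h0 _), hα', hα]
    congr 1
    simp only [stationaryLaw]
    field_simp
  · intro q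
    simp only [weight, if_true, Bool.false_eq_true, if_false]
    rw [← ENNReal.ofReal_mul hα1, ← ENNReal.ofReal_mul hα0, ← ENNReal.ofReal_mul (h0 _),
      ← ENNReal.ofReal_mul (h0 _), hα', hα]
    congr 1
    simp only [stationaryLaw, pow_succ]
    field_simp

/-- A large deviation bound for the number of departures from a tandem of `n + 1` queues. -/
theorem measure_tandem_lt_le (hp : 0 < p) (hσ : 0 < σ) (hσ1 : σ ≤ 1) (n N θ : ℕ) :
    trafficMeasure p {ω | tandem ω n N < θ} ≤
      ENNReal.ofReal (Real.exp (σ * θ - p * σ / (1 + σ) ^ 2 * N + n * Real.log 6)) := by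
  have hp1 := p.2.2
  have hp0 : 0 < (p : ℝ) := hp
  have hαp : (p : ℝ) / (1 + σ) ≤ p := div_le_self hp0.le (by linarith)
  set α : unitInterval := ⟨p / (1 + σ), by positivity, hαp.trans hp1⟩ with hα
  have hx : 0 < 1 / (1 + σ) := by positivity
  have hx1 : ENNReal.ofReal (1 / (1 + σ)) ≤ 1 := by
    rw [← ENNReal.ofReal_one]
    exact ENNReal.ofReal_le_ofReal (by rw [div_le_one] <;> linarith)
  have key := measure_tandem_lt_mul_le (p := p) (α := α) hx1 hαp
    (balanced_stationaryLaw hp hσ rfl) (tsum_stationaryLaw hσ).le n N θ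
  have key2 : trafficMeasure p {ω | tandem ω n N < θ} * ENNReal.ofReal (1 / (1 + σ)) ^ θ *
      ENNReal.ofReal (1 / 6) ^ n ≤
      (weight α true * ENNReal.ofReal (1 / (1 + σ)) + weight α false) ^ N := by
    refine le_trans ?_ key
    gcongr
    exact le_tsum_stationaryLaw hσ hσ1
  have hα1 : 0 ≤ 1 - (α : ℝ) := sub_nonneg.2 α.2.2
  have hlam : weight α true * ENNReal.ofReal (1 / (1 + σ)) + weight α false =
      ENNReal.ofReal (1 - p * σ / (1 + σ) ^ 2) := by
    simp only [weight, if_true, Bool.false_eq_true, if_false]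
    rw [← ENNReal.ofReal_mul α.2.1, ← ENNReal.ofReal_add (mul_nonneg α.2.1 hx.le) hα1]
    congr 1
    simp only [hα]
    field_simp
    ring
  have hlam0 : 0 ≤ 1 - p * σ / (1 + σ) ^ 2 := by
    rw [sub_nonneg, div_le_one (by positivity)]
    nlinarith
  rw [hlam, ← ENNReal.ofReal_pow hx.le, ← ENNReal.ofReal_pow (by norm_num),
    ← ENNReal.ofReal_pow hlam0, ← ENNReal.ofReal_toReal (measure_ne_top (trafficMeasure p) _),
    ← ENNReal.ofReal_mul ENNReal.toReal_nonneg, ← ENNReal.ofReal_mul (by positivity),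
    ENNReal.ofReal_le_ofReal_iff (by positivity)] at key2
  rw [← ENNReal.ofReal_toReal (measure_ne_top (trafficMeasure p) _)]
  refine ENNReal.ofReal_le_ofReal ?_
  set P := (trafficMeasure p {ω | tandem ω n N < θ}).toReal
  have e1 : (1 + σ) ^ θ ≤ Real.exp (σ * θ) := by
    rw [mul_comm, Real.exp_nat_mul]
    gcongr
    linarith [Real.add_one_le_exp σ]
  have e2 : (1 - p * σ / (1 + σ) ^ 2) ^ N ≤ Real.exp (-(p * σ / (1 + σ) ^ 2 * N)) := by
    rw [mul_comm _ (N : ℝ), ← mul_neg, Real.exp_nat_mul]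
    gcongr
    linarith [Real.add_one_le_exp (-(p * σ / (1 + σ) ^ 2))]
  have e3 : Real.exp (n * Real.log 6) = 6 ^ n := by
    rw [Real.exp_nat_mul, Real.exp_log (by norm_num)]
  calc P = P * (1 / (1 + σ)) ^ θ * (1 / 6) ^ n * ((1 + σ) ^ θ * 6 ^ n) := by
        rw [one_div, one_div, inv_pow, inv_pow]; field_simp
    _ ≤ (1 - p * σ / (1 + σ) ^ 2) ^ N * ((1 + σ) ^ θ * 6 ^ n) := by gcongr
    _ ≤ Real.exp (-(p * σ / (1 + σ) ^ 2 * N)) * (Real.exp (σ * θ) * Real.exp (n * Real.log 6)) := by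
        rw [e3]; gcongr
    _ = _ := by rw [← Real.exp_add, ← Real.exp_add]; congr 1; ring

end Stationary

/-! ### The threshold and the non-asymptotic bound -/

/-- The number of services of the last server after which the sink can decode, up to a probability
which is summable over time. -/
noncomputable def serviceThreshold (k L : ℕ) (ε : ℝ) (N : ℕ) : ℕ :=
  ⌈k + (L + 2) * Real.logb 2 (N + 1) + Real.logb 2 (2 / ε)⌉₊

section Threshold

variable {k L : ℕ} {ε : ℝ}

theorem serviceThreshold_le (hε0 : 0 < ε) (hε1 : ε < 1) (N : ℕ) :
    (serviceThreshold k L ε N : ℝ) ≤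
      k + 1 + (L + 2) * Real.logb 2 (N + 1) + Real.logb 2 (2 / ε) := by
  have h1 : 0 ≤ Real.logb 2 (N + 1) := Real.logb_nonneg (by norm_num) (by simp)
  have h2 : 0 ≤ Real.logb 2 (2 / ε) :=
    Real.logb_nonneg (by norm_num) (by rw [le_div_iff₀ hε0]; linarith)
  have := Nat.ceil_lt_add_one
    (show 0 ≤ k + (L + 2) * Real.logb 2 (N + 1) + Real.logb 2 (2 / ε) by positivity)
  rw [serviceThreshold]
  linarith

/-- The two extra logarithms in the threshold (`L + 2` against `L`) leave the summable factor `1 /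
(N + 1) ^ 2`, whose sum is at most 2. -/
theorem pow_serviceThreshold_le (hε0 : 0 < ε) (N : ℕ) :
    (2 : ℝ) ^ k * ((N + 1 : ℕ) ^ L * 2⁻¹ ^ serviceThreshold k L ε N) ≤
      ε / 2 * (1 / ((N : ℝ) + 1) ^ 2) := by
  have hN : (0 : ℝ) < N + 1 := by positivity
  have h : (2 : ℝ) ^ k * (((N : ℝ) + 1) ^ (L + 2) * (2 / ε)) ≤ 2 ^ serviceThreshold k L ε N := by
    have h1 := Nat.le_ceil (k + (L + 2) * Real.logb 2 (N + 1) + Real.logb 2 (2 / ε))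
    calc (2 : ℝ) ^ k * (((N : ℝ) + 1) ^ (L + 2) * (2 / ε))
        = (2 : ℝ) ^ (k + (L + 2) * Real.logb 2 (N + 1) + Real.logb 2 (2 / ε)) := by
          rw [Real.rpow_add two_pos, Real.rpow_add two_pos, Real.rpow_natCast,
            Real.rpow_logb two_pos (by norm_num) (by positivity), mul_comm ((L : ℝ) + 2),
            Real.rpow_mul two_pos.le, Real.rpow_logb two_pos (by norm_num) hN]
          rw [show (L : ℝ) + 2 = ((L + 2 : ℕ) : ℝ) by push_cast; ring, Real.rpow_natCast]
          ring
      _ ≤ (2 : ℝ) ^ ((serviceThreshold k L ε N : ℕ) : ℝ) :=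
          Real.rpow_le_rpow_of_exponent_le (by norm_num) h1
      _ = _ := Real.rpow_natCast _ _
  rw [inv_pow, Nat.cast_add, Nat.cast_one]
  have h2 : (0 : ℝ) < 2 ^ serviceThreshold k L ε N := by positivity
  calc (2 : ℝ) ^ k * (((N : ℝ) + 1) ^ L * (2 ^ serviceThreshold k L ε N)⁻¹)
      ≤ (2 : ℝ) ^ k * (((N : ℝ) + 1) ^ L *
        ((2 : ℝ) ^ k * (((N : ℝ) + 1) ^ (L + 2) * (2 / ε)))⁻¹) := by gcongr
    _ = ε / 2 * (1 / ((N : ℝ) + 1) ^ 2) := by rw [pow_add]; field_simp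

theorem tsum_pow_serviceThreshold_le (hε0 : 0 < ε) :
    ∑' N : ℕ, (2 : ℝ≥0∞) ^ k * ((N + 1 : ℕ) ^ L * 2⁻¹ ^ serviceThreshold k L ε N) ≤
      ENNReal.ofReal ε := by
  have hz : HasSum (fun N : ℕ => 1 / ((N : ℝ) + 1) ^ 2) (Real.pi ^ 2 / 6) := by
    have := (hasSum_nat_add_iff' 1).2 hasSum_zeta_two
    simpa using this
  have hpi : Real.pi ^ 2 / 6 ≤ 2 := by nlinarith [Real.pi_lt_d2, Real.pi_pos]
  calc _ ≤ ∑' N : ℕ, ENNReal.ofReal (ε / 2 * (1 / ((N : ℝ) + 1) ^ 2)) := by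
        refine ENNReal.tsum_le_tsum fun N => ?_
        refine le_trans (le_of_eq ?_) (ENNReal.ofReal_le_ofReal
          (pow_serviceThreshold_le (k := k) (L := L) hε0 N))
        rw [ENNReal.ofReal_mul (by positivity), ENNReal.ofReal_mul (by positivity),
          ENNReal.ofReal_pow (by norm_num), ENNReal.ofReal_pow (by positivity),
          ENNReal.ofReal_pow (by norm_num), ENNReal.ofReal_natCast,
          ENNReal.ofReal_inv_of_pos (by norm_num), ENNReal.ofReal_ofNat]
    _ = ENNReal.ofReal (ε / 2 * (Real.pi ^ 2 / 6)) := by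
        rw [← ENNReal.ofReal_tsum_of_nonneg (fun N => by positivity) (hz.mul_left _).summable,
          (hz.mul_left _).tsum_eq]
    _ ≤ _ := ENNReal.ofReal_le_ofReal (by nlinarith)

end Threshold

theorem logb_le_logb_add {a b : ℝ} (ha : 1 ≤ a) (hab : a ≤ b) :
    Real.logb 2 b ≤ Real.logb 2 a + 2 * (b - a) / a := by
  have ha0 : 0 < a := by linarith
  have h1 : Real.log (b / a) ≤ b / a - 1 := Real.log_le_sub_one_of_pos (div_pos (by linarith) ha0)
  rw [Real.log_div (by linarith) ha0.ne'] at h1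
  have h2 : (1 : ℝ) / 2 ≤ Real.log 2 := by linarith [Real.log_two_gt_d9]
  have h3 : Real.log b - Real.log a ≤ (b - a) / a := by
    rw [sub_div, div_self ha0.ne']; exact h1
  have h4 : 0 ≤ (b - a) / a := div_nonneg (by linarith) ha0.le
  rw [Real.logb, Real.logb, ← sub_le_iff_le_add', ← sub_div, div_le_iff₀ (by linarith)]
  calc _ ≤ (b - a) / a := h3
    _ ≤ 2 * (b - a) / a * Real.log 2 := by rw [mul_div_assoc]; nlinarith

/-- A quantitative sufficient condition for the expected number of slots before the tandem of
queues meets the threshold to be at most about `N₀`. -/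
theorem tsum_measure_tandem_lt_le {p : unitInterval} (hp : 0 < p) {σ ε : ℝ} (hσ : 0 < σ)
    (hσ1 : σ ≤ 1) (hε0 : 0 < ε) (hε1 : ε < 1) (k L N₀ : ℕ) (hN₀ : 1 ≤ N₀)
    (hslope : 2 * ((L : ℝ) + 3) / (N₀ + 1) ≤ p / 8)
    (hlevel : k + 1 + ((L : ℝ) + 3) * Real.logb 2 (N₀ + 1) + Real.logb 2 (2 / ε) +
      L * Real.log 6 / σ ≤ p * N₀ / (1 + σ) ^ 2) :
    ∑' N, trafficMeasure p {ω | tandem ω L N < serviceThreshold k (L + 1) ε N} ≤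
      ENNReal.ofReal (N₀ + (1 + 8 / (p * σ))) := by
  have hp1 := p.2.2
  have hp0 : 0 < (p : ℝ) := hp
  set c : ℝ := p * σ / 8 with hc
  have hc0 : 0 < c := by positivity
  have hbound : ∀ j : ℕ, trafficMeasure p
      {ω | tandem ω L (j + N₀) < serviceThreshold k (L + 1) ε (j + N₀)} ≤
        ENNReal.ofReal (Real.exp (-c) ^ j) := by
    intro j
    refine (measure_tandem_lt_le hp hσ hσ1 L (j + N₀) _).trans (ENNReal.ofReal_le_ofReal ?_)
    rw [← Real.exp_nat_mul]
    refine Real.exp_le_exp.2 ?_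
    have h1 := serviceThreshold_le (k := k) (L := L + 1) hε0 hε1 (j + N₀)
    have h2 := logb_le_logb_add (a := N₀ + 1) (b := ((j + N₀ : ℕ) : ℝ) + 1) (by simp)
      (by push_cast; linarith [(Nat.cast_nonneg j : (0 : ℝ) ≤ j)])
    have h3 : 2 * (((j + N₀ : ℕ) : ℝ) + 1 - (N₀ + 1)) / (N₀ + 1) = j * (2 / ((N₀ : ℝ) + 1)) := by
      push_cast; ring
    rw [h3] at h2
    push_cast at h1 h2 ⊢
    have hj : (0 : ℝ) ≤ j := Nat.cast_nonneg j
    have h4 : σ * (serviceThreshold k (L + 1) ε (j + N₀) : ℝ) ≤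
        σ * (k + 1 + ((L : ℝ) + 3) * (Real.logb 2 (N₀ + 1) + j * (2 / ((N₀ : ℝ) + 1))) +
          Real.logb 2 (2 / ε)) := by
      refine mul_le_mul_of_nonneg_left (h1.trans ?_) hσ.le
      have := mul_le_mul_of_nonneg_left h2 (show (0 : ℝ) ≤ (L : ℝ) + 3 by positivity)
      linarith
    have h5 : σ * (((L : ℝ) + 3) * (j * (2 / ((N₀ : ℝ) + 1)))) ≤ c * j := by
      have := mul_le_mul_of_nonneg_left hslope (show 0 ≤ σ * j by positivity)
      calc _ = σ * j * (2 * ((L : ℝ) + 3) / (N₀ + 1)) := by ring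
        _ ≤ _ := this
        _ = _ := by rw [hc]; ring
    have h6 := mul_le_mul_of_nonneg_left hlevel hσ.le
    have h7 : σ * (L * Real.log 6 / σ) = L * Real.log 6 := by field_simp
    -- The drift is at least `2 * c` per slot since `(1 + σ) ^ 2 ≤ 4`; the growth of the threshold
    -- uses up at most `c` of it, by `h5`.
    have h8 : 2 * c * j ≤ p * σ / (1 + σ) ^ 2 * j := by
      gcongr
      rw [le_div_iff₀ (by positivity), hc]
      have : (1 + σ) ^ 2 ≤ 4 := by nlinarith
      nlinarith [mul_pos hp0 hσ]
    have h9 : σ * (p * N₀ / (1 + σ) ^ 2) = p * σ / (1 + σ) ^ 2 * N₀ := by ring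
    rw [mul_add, mul_add, mul_add, h7, h9] at h6
    nlinarith
  -- Before `N₀` each probability is bounded by 1; from `N₀` on they decay geometrically.
  calc _ = ∑ N ∈ Finset.range N₀, trafficMeasure p
          {ω | tandem ω L N < serviceThreshold k (L + 1) ε N} +
        ∑' j, trafficMeasure p
          {ω | tandem ω L (j + N₀) < serviceThreshold k (L + 1) ε (j + N₀)} :=
        (ENNReal.summable.sum_add_tsum_nat_add' ).symm
    _ ≤ ∑ N ∈ Finset.range N₀, 1 + ∑' j : ℕ, ENNReal.ofReal (Real.exp (-c) ^ j) := by
        gcongr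
        · exact prob_le_one
        · exact hbound _
    _ = ENNReal.ofReal (N₀ + (1 - Real.exp (-c))⁻¹) := by
        have he : Real.exp (-c) < 1 := by
          rw [← Real.exp_zero]
          exact Real.exp_lt_exp.2 (by linarith)
        have hg := hasSum_geometric_of_lt_one (Real.exp_pos (-c)).le he
        rw [← ENNReal.ofReal_tsum_of_nonneg (fun j => by positivity) hg.summable, hg.tsum_eq,
          ENNReal.ofReal_add (by positivity) (inv_nonneg.2 (by linarith))]
        simp
    _ ≤ _ := by
        refine ENNReal.ofReal_le_ofReal ?_
        gcongr
        have h1 : Real.exp (-c) ≤ 1 / (1 + c) := by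
          rw [Real.exp_neg, ← one_div]
          exact one_div_le_one_div_of_le (by positivity) (by linarith [Real.add_one_le_exp c])
        have h2 : c / (1 + c) ≤ 1 - Real.exp (-c) := by
          have : c / (1 + c) = 1 - 1 / (1 + c) := by field_simp; ring
          linarith
        calc (1 - Real.exp (-c))⁻¹ ≤ (c / (1 + c))⁻¹ := inv_anti₀ (by positivity) h2
          _ = 1 + 8 / (p * σ) := by rw [hc]; field_simp; ring

set_option maxHeartbeats 800000 in
/-- The non-asymptotic bound on the `ε`-constrained average coding delay. -/
theorem constrainedAverageCodingDelay_le_of_le {p : unitInterval} (hp : 0 < p) {K : ℝ}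
    (hK : K = 6 + 3 * Real.logb 2 (20 / p)) {k L : ℕ} {ε : ℝ} (hL : 1 ≤ L) (hk : 2 ≤ k)
    (hε0 : 0 < ε) (hε1 : ε < 1) (hreg : 48 * K * (L * Real.logb 2 (k * L / ε)) ≤ k) :
    constrainedAverageCodingDelay k L p ε ≤
      ((1 / (p : ℝ) * (k + (4 * K * (L * Real.logb 2 (k * L / ε)) + 23 * √((k : ℝ) * L))) : ℝ) :
        EReal) := by
  obtain ⟨n, rfl⟩ : ∃ n, L = n + 1 := ⟨L - 1, by omega⟩
  have hp0 : 0 < (p : ℝ) := hp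
  have hp1 : (p : ℝ) ≤ 1 := p.2.2
  have hk' : (2 : ℝ) ≤ k := by exact_mod_cast hk
  have hL' : (1 : ℝ) ≤ ((n + 1 : ℕ) : ℝ) := by exact_mod_cast hL
  set l : ℝ := ((n + 1 : ℕ) : ℝ) with hl
  have hln : (n : ℝ) = l - 1 := by rw [hl]; push_cast; ring
  set g : ℝ := Real.logb 2 (20 / p) with hg
  have hg0 : 0 ≤ g := Real.logb_nonneg (by norm_num) (by rw [le_div_iff₀ hp0]; linarith)
  have hkl : (k : ℝ) ≤ k * l := le_mul_of_one_le_right (by linarith) hL'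
  have hklε : (k : ℝ) * l ≤ k * l / ε := le_div_self (by positivity) hε0 hε1.le
  set ell : ℝ := Real.logb 2 (k * l / ε) with hell
  have hlogk : Real.logb 2 k ≤ ell :=
    Real.logb_le_logb_of_le (by norm_num) (by positivity) (hkl.trans hklε)
  have hell1 : 1 ≤ ell := by
    rw [hell, Real.le_logb_iff_rpow_le (by norm_num) (by positivity), Real.rpow_one]
    linarith
  have hlogε : Real.logb 2 (2 / ε) ≤ 1 + ell := by
    rw [div_eq_mul_one_div, Real.logb_mul (by norm_num) (by positivity),
      Real.logb_self_eq_one (by norm_num)]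
    gcongr
    refine Real.logb_le_logb_of_le (by norm_num) (by positivity) ?_
    gcongr
    linarith
  set Λ : ℝ := l * ell with hΛ
  have hΛl : l ≤ Λ := le_mul_of_one_le_right (by linarith) hell1
  have hΛe : ell ≤ Λ := le_mul_of_one_le_left (by linarith) hL'
  have hKΛ : 6 * Λ ≤ K * Λ := by
    have : 6 ≤ K := by rw [hK]; linarith
    exact mul_le_mul_of_nonneg_right this (by linarith)
  set s : ℝ := √(k * l) with hs
  have hs2 : s * s = k * l := Real.mul_self_sqrt (by positivity)
  have hs1 : 1 ≤ s := by rw [hs, Real.one_le_sqrt]; linarith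
  have hsk : 16 * s ≤ k := by
    have h1 : (16 * s) ^ 2 ≤ (k : ℝ) ^ 2 := by
      have h2 : 256 * l ≤ k := by linarith
      calc (16 * s) ^ 2 = k * (256 * l) := by rw [mul_pow, sq s, hs2]; ring
        _ ≤ k * k := by gcongr
        _ = _ := (sq _).symm
    exact (sq_le_sq₀ (by positivity) (by positivity)).1 h1 
  -- That is `√(l / k)`, which balances the slowdown `σ * k` against the start-up cost `l / σ`: both
  -- equal `s`.
  set σ : ℝ := s / k with hσdef
  have hσ0 : 0 < σ := by positivity
  have hσk : σ * k = s := by rw [hσdef]; field_simp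
  have hσ16 : σ ≤ 1 / 16 := by
    rw [hσdef, div_le_iff₀ (by linarith)]; linarith
  have hlσ : l / σ = s := by
    rw [div_eq_iff hσ0.ne', hσdef, mul_div_assoc', hs2]; field_simp
  have hinvσ : 1 / σ ≤ s := by
    rw [← hlσ]; gcongr
  -- `K * Λ` covers the logarithmic terms of the threshold, and `2 * s` the cost of starting with
  -- empty queues, as `log 6 ≤ 2`.
  set M : ℝ := K * Λ + 2 * s with hM
  have hM0 : 0 ≤ M := by linarith
  have hMk : M ≤ k := by linarith
  -- The factor `1 + 3 * σ` dominates `(1 + σ) ^ 2` because `σ ≤ 1`.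
  set N₀ : ℕ := ⌈(1 + 3 * σ) * (k + M) / p⌉₊ with hN₀
  have hN₀ge : (1 + 3 * σ) * (k + M) ≤ p * N₀ := by
    have := Nat.le_ceil ((1 + 3 * σ) * (k + M) / p)
    rw [div_le_iff₀ hp0] at this
    rw [mul_comm (p : ℝ)]; exact this
  have hN₀le : (N₀ : ℝ) ≤ (1 + 3 * σ) * (k + M) / p + 1 :=
    (Nat.ceil_lt_add_one (by positivity)).le
  have hkN : (k : ℝ) ≤ p * N₀ := by
    have : (k : ℝ) + M ≤ (1 + 3 * σ) * (k + M) :=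
      le_mul_of_one_le_left (by linarith) (by linarith)
    linarith
  have hlogN : Real.logb 2 (N₀ + 1) ≤ g + ell := by
    have h1 : (N₀ : ℝ) + 1 ≤ 20 / p * k := by
      have h2 : (1 + 3 * σ) * (k + M) ≤ 8 * k := by
        calc (1 + 3 * σ) * (k + M) ≤ 4 * (2 * k) := by gcongr <;> linarith
          _ = _ := by ring
      have h3 : (1 + 3 * σ) * (k + M) / p ≤ 8 * k / p := by gcongr
      have h4 : (k : ℝ) ≤ k / p := le_div_self (by linarith) hp0 hp1
      have h5 : 20 / (p : ℝ) * k = 20 * (k / p) := by ring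
      have h6 : 8 * (k : ℝ) / p = 8 * (k / p) := by ring
      linarith
    calc Real.logb 2 (N₀ + 1) ≤ Real.logb 2 (20 / p * k) :=
          Real.logb_le_logb_of_le (by norm_num) (by positivity) h1
      _ = g + Real.logb 2 k := Real.logb_mul (by positivity) (by positivity)
      _ ≤ _ := by linarith
  have hlog6 : Real.log 6 ≤ 2 := by
    rw [Real.log_le_iff_le_exp (by norm_num)]
    have h1 := Real.exp_one_gt_d9
    have h2 : Real.exp 2 = Real.exp 1 * Real.exp 1 := by rw [← Real.exp_add]; norm_num
    nlinarith only [h1, h2]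
  have key := tsum_measure_tandem_lt_le hp hσ0 (by linarith) hε0 hε1 k n N₀
    (by
      have h1 : (p : ℝ) * N₀ ≤ N₀ := mul_le_of_le_one_left (Nat.cast_nonneg _) hp1
      have : (1 : ℝ) ≤ N₀ := by linarith
      exact_mod_cast this)
    (by
      rw [hln, div_le_div_iff₀ (by positivity) (by norm_num), mul_add]
      linarith)
    (by
      rw [hln, le_div_iff₀ (by positivity)]
      have h1 : (l - 1) * Real.log 6 / σ ≤ 2 * s := by
        rw [← hlσ, mul_div_assoc', div_le_div_iff_of_pos_right hσ0]
        rw [mul_comm]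
        exact mul_le_mul hlog6 (by linarith) (by linarith) (by norm_num)
      have h2 : (l - 1 + 3) * Real.logb 2 (N₀ + 1) ≤ 3 * l * (g + ell) := by
        have h0 : 0 ≤ Real.logb 2 ((N₀ : ℝ) + 1) := Real.logb_nonneg (by norm_num) (by simp)
        exact mul_le_mul (by linarith) hlogN h0 (by positivity)
      have h3 : 3 * l * (g + ell) ≤ 3 * g * Λ + 3 * Λ := by
        have h4 : g * l ≤ g * Λ := by gcongr
        calc 3 * l * (g + ell) = 3 * (g * l) + 3 * Λ := by rw [hΛ]; ring
          _ ≤ _ := by linarith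
      have h4 : K * Λ = 6 * Λ + 3 * g * Λ := by rw [hK]; ring
      have h5 : (k : ℝ) + 1 + (l - 1 + 3) * Real.logb 2 (N₀ + 1) + Real.logb 2 (2 / ε) +
          (l - 1) * Real.log 6 / σ ≤ k + M := by linarith
      calc _ ≤ (k + M) * (1 + σ) ^ 2 := by gcongr
        _ ≤ (1 + 3 * σ) * (k + M) := by
          rw [mul_comm]
          refine mul_le_mul_of_nonneg_right ?_ (by linarith)
          nlinarith only [hσ0, hσ16]
        _ ≤ _ := hN₀ge)
  set Z : ℤ := ⌈(N₀ : ℝ) + (1 + 8 / (p * σ)) + 1⌉ with hZ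
  have hZge : (N₀ : ℝ) + (1 + 8 / (p * σ)) + 1 ≤ Z := Int.le_ceil _
  have hZle : (Z : ℝ) ≤ N₀ + (1 + 8 / (p * σ)) + 1 + 1 := (Int.ceil_lt_add_one _).le
  refine (constrainedAverageCodingDelay_le n p ε (serviceThreshold k (n + 1) ε) Z ?_
    (tsum_pow_serviceThreshold_le hε0)).trans (EReal.coe_le_coe_iff.2 ?_)
  · refine (add_le_add_left key 1).trans ?_
    rw [← ENNReal.ofReal_one, ← ENNReal.ofReal_add (by positivity) (by norm_num)]
    exact ENNReal.ofReal_le_ofReal hZge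
  · have h1 : 8 / (p * σ) ≤ 8 * s / p := by
      have : 8 / (p * σ) = 8 * (1 / σ) / p := by field_simp
      rw [this]; gcongr
    have h2 : (4 : ℝ) ≤ 4 * s / p := by
      rw [le_div_iff₀ hp0]; linarith
    have h3 : (1 + 3 * σ) * (k + M) ≤ k + 3 * s + 2 * M := by
      have : 3 * σ * M ≤ 1 * M := by gcongr; linarith
      calc (1 + 3 * σ) * (k + M) = k + 3 * (σ * k) + M + 3 * σ * M := by ring
        _ ≤ _ := by rw [hσk]; linarith
    have h4 : (1 + 3 * σ) * (k + M) / p ≤ (k + 3 * s + 2 * M) / p := by gcongr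
    -- The term `8 * s / p` is the geometric tail after `N₀`; `4 * s / p` absorbs four units: two
    -- ceilings, the first term of the tail, and the slot from Markov's inequality.
    calc (Z : ℝ) ≤ (k + 3 * s + 2 * M) / p + 8 * s / p + 4 * s / p := by linarith
      _ = 1 / p * (k + (2 * K * Λ + 19 * s)) := by rw [hM]; ring
      _ ≤ _ := by
        gcongr ?_ * (_ + ?_)
        linarith

/-! ### Asymptotics -/

/-- Each term on the left is at most a quarter of `√(k * L * m)`: the first because `L * m` is small
against `k`, the second because `m` is large (`92 = 4 * 23`). -/
theorem mul_add_sqrt_le_sqrt {B k L m : ℝ} (hk : 0 ≤ k) (hL : 0 ≤ L)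
    (hm : 92 ^ 2 ≤ m) (h : 16 * B ^ 2 * (L * m) ≤ k) :
    B * (L * m) + 23 * √(k * L) ≤ 1 / 2 * √(k * L * m) := by
  have hm0 : 0 ≤ m := le_trans (by norm_num) hm
  have h1 : 4 * (B * (L * m)) ≤ √(k * L * m) := by
    refine Real.le_sqrt_of_sq_le ?_
    calc (4 * (B * (L * m))) ^ 2 = 16 * B ^ 2 * (L * m) * (L * m) := by ring
      _ ≤ k * (L * m) := by gcongr
      _ = _ := by ring
  have h2 : 92 * √(k * L) ≤ √(k * L * m) := by
    rw [Real.sqrt_mul (by positivity) m, mul_comm]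
    gcongr
    exact Real.le_sqrt_of_sq_le hm
  linarith

section Asymptotics

variable {L : ℕ → ℕ} {ε : ℕ → ℝ}

theorem logb_le_logb_mul_div {k L : ℕ} {ε : ℝ} (hk : 1 ≤ k) (hL : 1 ≤ L) (hε0 : 0 < ε)
    (hε1 : ε < 1) : Real.logb 2 k ≤ Real.logb 2 (k * L) ∧
      Real.logb 2 (k * L) ≤ Real.logb 2 (k * L / ε) := by
  have hk' : (1 : ℝ) ≤ k := by exact_mod_cast hk
  have hL' : (1 : ℝ) ≤ L := by exact_mod_cast hL
  exact ⟨Real.logb_le_logb_of_le (by norm_num) (by positivity)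
    (le_mul_of_one_le_right (by positivity) hL'),
    Real.logb_le_logb_of_le (by norm_num) (by positivity)
      (le_div_self (by positivity) hε0 hε1.le)⟩

theorem eventually_le_logb (D : ℝ) : ∀ᶠ k : ℕ in atTop, D ≤ Real.logb 2 k :=
  ((Real.tendsto_logb_atTop (by norm_num)).comp tendsto_natCast_atTop_atTop).eventually_ge_atTop D

theorem eventually_mul_le
    (hreg : Tendsto (fun k : ℕ => (L k : ℝ) * Real.logb 2 (k * L k / ε k) / k) atTop (𝓝 0))
    {D : ℝ} (hD : 0 < D) :
    ∀ᶠ k : ℕ in atTop, D * (L k * Real.logb 2 (k * L k / ε k)) ≤ k := by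
  filter_upwards [hreg.eventually_le_const (show (0 : ℝ) < 1 / D by positivity),
    eventually_ge_atTop 1] with k hk hk1
  have hk0 : (0 : ℝ) < k := by exact_mod_cast hk1
  rw [div_le_iff₀ hk0, one_div, inv_mul_eq_div, le_div_iff₀ hD] at hk
  linarith

theorem eventually_constrainedAverageCodingDelay_le {p : unitInterval} (hp : 0 < p)
    (hL : ∀ k, 1 ≤ L k) (hε0 : ∀ k, 0 < ε k) (hε1 : ∀ k, ε k < 1)
    (hreg : Tendsto (fun k : ℕ => (L k : ℝ) * Real.logb 2 (k * L k / ε k) / k) atTop (𝓝 0)) :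
    ∃ B : ℝ, 0 < B ∧ ∀ᶠ k : ℕ in atTop, constrainedAverageCodingDelay k (L k) p (ε k) ≤
      ((1 / (p : ℝ) * (k + (B * (L k * Real.logb 2 (k * L k / ε k)) +
        23 * √((k : ℝ) * L k))) : ℝ) : EReal) := by
  have hp0 : 0 < (p : ℝ) := hp
  have hg0 : 0 ≤ Real.logb 2 (20 / p) := Real.logb_nonneg (by norm_num) (by
    rw [le_div_iff₀ hp0]; linarith [p.2.2])
  refine ⟨4 * (6 + 3 * Real.logb 2 (20 / p)), by positivity, ?_⟩
  filter_upwards [eventually_mul_le hreg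
    (show 0 < 48 * (6 + 3 * Real.logb 2 (20 / p)) by positivity), eventually_ge_atTop 2] with k h hk
  exact constrainedAverageCodingDelay_le_of_le hp rfl (hL k) hk (hε0 k) (hε1 k) h

/-- The term `k * L / w` alone suffices: eventually `w` is at most twice its asymptotic value. The
other term is nonnegative since `w ≥ 1` eventually. -/
theorem eventually_sqrt_le_window_cost {p : unitInterval} (hp : 0 < p)
    (hL : ∀ k, 1 ≤ L k) (hε0 : ∀ k, 0 < ε k) (hε1 : ∀ k, ε k < 1)
    (hreg : Tendsto (fun k : ℕ => (L k : ℝ) * Real.logb 2 (k * L k / ε k) / k) atTop (𝓝 0))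
    {w : ℕ → ℝ}
    (hw : w ~[atTop] fun k : ℕ => √((k : ℝ) * L k / Real.logb 2 (k * L k / (p * ε k)))) :
    ∀ᶠ k : ℕ in atTop, 1 / 2 * √((k : ℝ) * L k * Real.logb 2 (k * L k / ε k)) ≤
      (k : ℝ) * L k / w k + w k * Real.logb 2 (w k * L k / ε k) := by
  have hp0 : 0 < (p : ℝ) := hp
  have hp1 : (p : ℝ) ≤ 1 := p.2.2
  have hnear : ∀ᶠ k : ℕ in atTop,
      |w k - √((k : ℝ) * L k / Real.logb 2 (k * L k / (p * ε k)))| ≤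
        1 / 2 * |√((k : ℝ) * L k / Real.logb 2 (k * L k / (p * ε k)))| :=
    hw.isLittleO.bound (by norm_num : (0 : ℝ) < 1 / 2)
  filter_upwards [hnear, eventually_mul_le hreg (show (0 : ℝ) < 8 by norm_num),
    eventually_le_logb (max 1 (Real.logb 2 (1 / p))), eventually_ge_atTop 2] with k hwk hk hlog hk2
  have hk' : (2 : ℝ) ≤ k := by exact_mod_cast hk2
  have hL' : (1 : ℝ) ≤ L k := by exact_mod_cast hL k
  have hε0 := hε0 k
  have hε1 := hε1 k
  obtain ⟨h1, h2⟩ := logb_le_logb_mul_div (k := k) (by omega) (hL k) hε0 hε1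
  set ell : ℝ := Real.logb 2 (k * L k / ε k) with hell
  have hsplit : Real.logb 2 (k * L k / (p * ε k)) = ell + Real.logb 2 (1 / p) := by
    rw [hell, ← Real.logb_mul (by positivity) (by positivity)]
    congr 1
    field_simp
  have hp' : 0 ≤ Real.logb 2 (1 / p) :=
    Real.logb_nonneg (by norm_num) (by rw [le_div_iff₀ hp0]; linarith)
  set ellp : ℝ := Real.logb 2 (k * L k / (p * ε k)) with hellp
  have hell1 : 1 ≤ ell := by linarith [le_max_left 1 (Real.logb 2 (1 / p))]
  have hle : ell ≤ ellp := by linarith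
  have hle2 : ellp ≤ 2 * ell := by linarith [le_max_right 1 (Real.logb 2 (1 / p))]
  have hellp0 : 0 < ellp := by linarith
  set v : ℝ := √((k : ℝ) * L k / ellp) with hv
  have hv2 : 2 ≤ v := by
    refine Real.le_sqrt_of_sq_le ?_
    rw [le_div_iff₀ hellp0]
    have h3 : ell ≤ L k * ell := le_mul_of_one_le_left (by linarith) hL'
    have h4 : (k : ℝ) ≤ k * L k := le_mul_of_one_le_right (by linarith) hL'
    linarith
  rw [abs_of_nonneg (by linarith : 0 ≤ v), abs_le] at hwk
  have hw1 : 1 ≤ w k := by linarith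
  have hw2 : w k ≤ 2 * v := by linarith
  have hfirst : 1 / 2 * √((k : ℝ) * L k * ell) ≤ k * L k / w k := by
    rw [le_div_iff₀ (by linarith)]
    calc 1 / 2 * √((k : ℝ) * L k * ell) * w k
        ≤ 1 / 2 * √((k : ℝ) * L k * ellp) * (2 * v) := by gcongr
      _ = √((k : ℝ) * L k * ellp) * v := by ring
      _ = √(((k : ℝ) * L k) ^ 2) := by
          rw [hv, ← Real.sqrt_mul (by positivity)]
          congr 1
          field_simp
      _ = k * L k := Real.sqrt_sq (by positivity)
  have hsecond : 0 ≤ w k * Real.logb 2 (w k * L k / ε k) := by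
    refine mul_nonneg (by linarith) (Real.logb_nonneg (by norm_num) ?_)
    rw [le_div_iff₀ hε0]
    nlinarith
  linarith

end Asymptotics

end LineNetwork

theorem mainTheorem3 (p : unitInterval) (hp0 : 0 < p) (hp1 : p < 1)
    (L : ℕ → ℕ) (hL : ∀ k, 1 ≤ L k)
    (ε : ℕ → ℝ) (hε0 : ∀ k, 0 < ε k) (hε1 : ∀ k, ε k < 1)
    (hreg : Tendsto (fun k : ℕ => (L k : ℝ) * Real.logb 2 (k * L k / ε k) / k) atTop (𝓝 0))
    (w : ℕ → ℝ)
    (hw : w ~[atTop] fun k : ℕ => √((k : ℝ) * L k / Real.logb 2 (k * L k / (p * ε k)))) :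
    (∃ o : ℕ → ℝ, Tendsto o atTop (𝓝 0) ∧
      ∀ᶠ k : ℕ in atTop,
        LineNetwork.constrainedAverageCodingDelay k (L k) p (ε k) ≤
          ((1 / (p : ℝ) * (k + (1 + o k) *
            ((k : ℝ) * L k / w k + w k * Real.logb 2 (w k * L k / ε k))) : ℝ) : EReal)) ∧
    (∀ c : ℝ, (∀ᶠ k : ℕ in atTop, (k : ℝ) ^ (-c) ≤ ε k) →
      ∃ o : ℕ → ℝ, Tendsto o atTop (𝓝 0) ∧
        ∀ᶠ k : ℕ in atTop,
          LineNetwork.constrainedAverageCodingDelay k (L k) p (ε k) ≤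
            ((1 / (p : ℝ) * (k + (1 + o k) *
              √((k : ℝ) * L k * Real.logb 2 (k * L k))) : ℝ) : EReal)) := by
  have hp : 0 < (p : ℝ) := hp0
  obtain ⟨B, hB, hbound⟩ :=
    LineNetwork.eventually_constrainedAverageCodingDelay_le hp0 hL hε0 hε1 hreg
  -- The proved excess is eventually below half of `√(k * L * log (k * L / ε))`, and in the
  -- polynomial case below half of `√(k * L * log (k * L))`, so the error term can be 0.
  refine ⟨⟨fun _ => 0, tendsto_const_nhds, ?_⟩, fun c hc => ⟨fun _ => 0, tendsto_const_nhds, ?_⟩⟩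
  · filter_upwards [hbound, LineNetwork.eventually_sqrt_le_window_cost hp0 hL hε0 hε1 hreg hw,
      LineNetwork.eventually_le_logb (92 ^ 2), eventually_ge_atTop 1,
      LineNetwork.eventually_mul_le hreg (show 0 < 16 * B ^ 2 by positivity)]
      with k hk hcost hlog hk1 hBk
    refine hk.trans (EReal.coe_le_coe_iff.2 ?_)
    obtain ⟨h1, h2⟩ := LineNetwork.logb_le_logb_mul_div hk1 (hL k) (hε0 k) (hε1 k)
    gcongr
    rw [add_zero, one_mul]
    exact (LineNetwork.mul_add_sqrt_le_sqrt (Nat.cast_nonneg k) (Nat.cast_nonneg (L k))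
      (by linarith) hBk).trans hcost
  · filter_upwards [hbound, hc, LineNetwork.eventually_le_logb (92 ^ 2), eventually_ge_atTop 1,
      LineNetwork.eventually_mul_le hreg
        (show 0 < 16 * (B * (1 + |c|)) ^ 2 by positivity)] with k hk hck hlog hk1 hBk
    refine hk.trans (EReal.coe_le_coe_iff.2 ?_)
    obtain ⟨h1, h2⟩ := LineNetwork.logb_le_logb_mul_div hk1 (hL k) (hε0 k) (hε1 k)
    have hk0 : (0 : ℝ) < k := by exact_mod_cast hk1
    have hL0 : (0 : ℝ) < L k := by exact_mod_cast hL k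
    have hε : -(c * Real.logb 2 k) ≤ Real.logb 2 (ε k) := by
      rw [← neg_mul, ← Real.logb_rpow_eq_mul_logb_of_pos hk0]
      exact Real.logb_le_logb_of_le (by norm_num) (by positivity) hck
    -- Polynomial decay of `ε` changes the logarithm only by a constant factor, which is absorbed
    -- into `B`.
    have hell : Real.logb 2 (k * L k / ε k) ≤ (1 + |c|) * Real.logb 2 (k * L k) := by
      rw [Real.logb_div (by positivity) (hε0 k).ne']
      have h3 : c * Real.logb 2 k ≤ |c| * Real.logb 2 (k * L k) := by
        calc c * Real.logb 2 k ≤ |c| * Real.logb 2 k := by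
              gcongr
              exact le_abs_self c
          _ ≤ _ := by gcongr
      linarith
    gcongr
    rw [add_zero, one_mul]
    calc B * (L k * Real.logb 2 (k * L k / ε k)) + 23 * √((k : ℝ) * L k)
        ≤ B * (L k * ((1 + |c|) * Real.logb 2 (k * L k))) + 23 * √((k : ℝ) * L k) := by gcongr
      _ = B * (1 + |c|) * (L k * Real.logb 2 (k * L k)) + 23 * √((k : ℝ) * L k) := by ring
      _ ≤ 1 / 2 * √((k : ℝ) * L k * Real.logb 2 (k * L k)) := by
          refine LineNetwork.mul_add_sqrt_le_sqrt hk0.le hL0.le (by linarith) (le_trans ?_ hBk)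
          gcongr
      _ ≤ _ := by linarith [Real.sqrt_nonneg ((k : ℝ) * L k * Real.logb 2 (k * L k))]
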